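/- Let $a\ge 2$ be an integer, let $\alpha$ be a non-real root of $x^3-ax^2+x-1$, put $u=\alpha-1$, and let $$\mathcal R_a=\Big\{\sum_{i=2}^{\infty}\varepsilon_i\alpha^i \;:\; \varepsilon_i\in\{0,\dots,a-1\},\ \varepsilon_i\varepsilon_{i-1}\varepsilon_{i-2}\varepsilon_{i-3}<_{lex}(a-1)(a-1)01\ \text{ for all } i\ge 2,\ \text{where } \varepsilon_1=\varepsilon_0=\varepsilon_{-1}=0\Big\}.$$ Let $L=\mathbb Z u+\mathbb Z\alpha u$ and $B=\{\pm u,\ \pm\alpha u,\ \pm(1+\alpha)u,\ \pm(1-\alpha)u\}$. Then: 1. $\mathcal R_a$ induces a periodic tiling of $\mathbb C$ modulo $L$, that is, $\mathbb C=\bigcup_{v\in L}(\mathcal R_a+v)$, and if $v,w\in L$ satisfy $\operatorname{int}(\mathcal R_a+v)\cap(\mathcal R_a+w)\neq\emptyset$, then $v=w$. 2. $\partial\mathcal R_a=\bigcup_{v\in B}\mathcal R_a\cap(\mathcal R_a+v)$. 3. $\mathcal R_a$ has exactly $8$ neighbors: the set $B$ has $8$ elements, and $B$ is the set of all $v\in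 L\setminus\{0\}$ with $\mathcal R_a\cap(\mathcal R_a+v)\neq\emptyset$. 4. $\mathcal R_a\cap(\mathcal R_a+(1+\alpha)u)=\{-1\}$ and $\mathcal R_a\cap(\mathcal R_a+(\alpha-1)u)=\{-\alpha\}$. -/

import Mathlib

open Pointwise

/-- Digit strings `(εᵢ)_{i ≥ 2}` (extended by `0` to all `i < 2`) such that every window
`εᵢ εᵢ₋₁ εᵢ₋₂ εᵢ₋₃` with `i ≥ 2` is lexicographically smaller than `(a-1)(a-1)01`.
The order `<` on `List ℕ` is the lexicographic one; the condition forces `εᵢ ≤ a - 1`. -/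
def RauzyAdmissible (a : ℕ) (ε : ℤ → ℕ) : Prop :=
  (∀ i : ℤ, i < 2 → ε i = 0) ∧
    ∀ i : ℤ, 2 ≤ i → [ε i, ε (i - 1), ε (i - 2), ε (i - 3)] < [a - 1, a - 1, 0, 1]

/-- The Rauzy fractal: all sums `∑_{i ≥ 2} εᵢ αⁱ` over admissible digit strings. -/
def rauzyFractal (a : ℕ) (α : ℂ) : Set ℂ :=
  {z | ∃ ε : ℤ → ℕ, RauzyAdmissible a ε ∧
    HasSum (fun n : ℕ => (ε ((n : ℤ) + 2) : ℂ) * α ^ (n + 2)) z}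

/-- The subgroup `ℤ w₁ + ℤ w₂` of `ℂ`, as a set. -/
def latticeSpan (w₁ w₂ : ℂ) : Set ℂ :=
  {z | ∃ m n : ℤ, z = m * w₁ + n * w₂}

/-- The set `T` induces a periodic tiling of the plane modulo `L`: the translates of `T` by `L`
cover the plane, and the interior of a translate meets no other translate. -/
def InducesPeriodicTiling (T L : Set ℂ) : Prop :=
  (⋃ v ∈ L, (v +ᵥ T)) = Set.univ ∧
    ∀ v ∈ L, ∀ w ∈ L, (interior (v +ᵥ T) ∩ (w +ᵥ T)).Nonempty → v = w

/-- The nonzero `v ∈ L` for which the translate `T + v` meets `T`. -/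
def neighborVectors (T L : Set ℂ) : Set ℂ :=
  {v | v ∈ L ∧ v ≠ 0 ∧ (T ∩ (v +ᵥ T)).Nonempty}

/-- The vectors `±u, ±αu, ±(1+α)u, ±(1-α)u` with `u = α - 1`. -/
def rauzyVectors (α : ℂ) : Set ℂ :=
  {α - 1, -(α - 1), α * (α - 1), -(α * (α - 1)),
    (1 + α) * (α - 1), -((1 + α) * (α - 1)), (1 - α) * (α - 1), -((1 - α) * (α - 1))}

/-! In the basis `1, α, α²` of `ℤ[α]`, the coordinate sum sends `α ^ n` to `T_n = rauzyNum a n`, and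
its kernel is the lattice `L`. The window condition says that every prefix of a digit string is the
greedy expansion of an integer in the base `T` (`RauzyDigits.digitValue_lt`,
`rauzyDigits_of_digitValue_lt`). So an element of `ℤ[α]` with coordinate sum `N ≥ 0`, minus the
expansion of `N` read in powers of `α`, lies in `L`. Such elements are dense, and compactness of the
fractal with local finiteness of its translates gives the covering.

Everything else rests on carries. If `z = v + z'` with `v ∈ L`, comparing the two expansions digit
by digit produces integers `p j` whose first three terms encode `v`. Convergence of the tails and
`‖α‖ < 1` make `p` bounded; greediness, read through the coordinate sum, gives the inequality
`CarryBound.value`. Together they force `|p j| ≤ 1` (`CarryBound.abs_le_one`, `exists_carries`), so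
only finitely many carry states remain.

Hence a neighbor `m u + n α u` has `m, n ∈ {-1, 0, 1}`, and explicit 4-periodic expansions realize
all eight nonzero pairs. For `(1 + α) u` and `(α - 1) u` the carries are forced at every step,
leaving one point. For disjointness of interiors, `killingWord` cannot be read along nonzero states:
inserted far out in an expansion whose point stays interior, it forces a zero state, which
propagates back to `v = 0`. The boundary formula combines covering, local finiteness and this
disjointness. -/

/-! ### The base sequence and greedy expansions of integers -/

/-- The base sequence `1, 1, 1, a, a², …` of the numeration system attached to
`x³ - a x² + x - 1`. -/
def rauzyNum (a : ℕ) : ℕ → ℤ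
  | 0 => 1
  | 1 => 1
  | 2 => 1
  | n + 3 => a * rauzyNum a (n + 2) - rauzyNum a (n + 1) + rauzyNum a n

/-- The window condition `x y z w <_lex (a-1)(a-1)01`, in elementary terms. -/
def RauzyWindow (a x y z w : ℕ) : Prop :=
  x + 1 < a ∨ (x + 1 = a ∧ (y + 1 < a ∨ (y + 1 = a ∧ z = 0 ∧ w = 0)))

/-- Admissible digit strings, indexed by the natural numbers. -/
structure RauzyDigits (a : ℕ) (d : ℕ → ℕ) : Prop where
  zero : d 0 = 0
  one : d 1 = 0
  two : d 2 < a
  window : ∀ n, RauzyWindow a (d (n + 3)) (d (n + 2)) (d (n + 1)) (d n)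

/-- The integer represented by the digits of index `< k`. -/
def digitValue (a : ℕ) (d : ℕ → ℕ) (k : ℕ) : ℤ :=
  ∑ i ∈ Finset.range k, (d i : ℤ) * rauzyNum a i

lemma digitValue_succ (a : ℕ) (d : ℕ → ℕ) (k : ℕ) :
    digitValue a d (k + 1) = digitValue a d k + d k * rauzyNum a k := by
  simp [digitValue, Finset.sum_range_succ]

lemma digitValue_zero (a : ℕ) (d : ℕ → ℕ) : digitValue a d 0 = 0 := by
  simp [digitValue]

lemma rauzyNum_add_three (a n : ℕ) :
    rauzyNum a (n + 3) = a * rauzyNum a (n + 2) - rauzyNum a (n + 1) + rauzyNum a n := by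
  rw [rauzyNum]

/-- Multiplying the characteristic polynomial by `x + 1` gives this relation. It explains the
critical word `(a-1)(a-1)01`: its value is exactly one unit of the next place. -/
lemma rauzyNum_add_four (a n : ℕ) :
    rauzyNum a (n + 4) =
      (a - 1) * rauzyNum a (n + 3) + (a - 1) * rauzyNum a (n + 2) + rauzyNum a n := by
  have h1 := rauzyNum_add_three a n
  have h2 := rauzyNum_add_three a (n + 1)
  simp only [add_assoc, Nat.reduceAdd] at h2
  rw [h2]
  linear_combination h1

lemma rauzyNum_pos_and_le {a : ℕ} (ha : 2 ≤ a) (n : ℕ) :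
    (1 ≤ rauzyNum a n ∧ rauzyNum a n ≤ rauzyNum a (n + 1)) ∧
    (1 ≤ rauzyNum a (n + 1) ∧ rauzyNum a (n + 1) ≤ rauzyNum a (n + 2)) := by
  induction n with
  | zero => simp [rauzyNum]
  | succ n ih =>
    obtain ⟨⟨h1, h2⟩, h3, h4⟩ := ih
    refine ⟨⟨h3, h4⟩, h3.trans h4, ?_⟩
    show rauzyNum a (n + 2) ≤ rauzyNum a (n + 3)
    rw [rauzyNum_add_three]
    have : (2 : ℤ) ≤ a := by exact_mod_cast ha
    nlinarith

lemma rauzyNum_pos {a : ℕ} (ha : 2 ≤ a) (n : ℕ) : 1 ≤ rauzyNum a n :=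
  (rauzyNum_pos_and_le ha n).1.1

lemma rauzyNum_le_succ {a : ℕ} (ha : 2 ≤ a) (n : ℕ) : rauzyNum a n ≤ rauzyNum a (n + 1) :=
  (rauzyNum_pos_and_le ha n).1.2

lemma rauzyNum_mono {a : ℕ} (ha : 2 ≤ a) : Monotone (rauzyNum a) :=
  monotone_nat_of_le_succ (rauzyNum_le_succ ha)

lemma le_rauzyNum {a : ℕ} (ha : 2 ≤ a) (n : ℕ) : (n : ℤ) + 1 ≤ rauzyNum a (n + 2) := by
  induction n with
  | zero => simp [rauzyNum]
  | succ n ih =>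
    show ((n + 1 : ℕ) : ℤ) + 1 ≤ rauzyNum a (n + 3)
    rw [rauzyNum_add_three]
    have : (2 : ℤ) ≤ a := by exact_mod_cast ha
    have h1 := rauzyNum_pos ha n
    have h2 := rauzyNum_le_succ ha (n + 1)
    have h3 := rauzyNum_pos ha (n + 2)
    simp only [add_assoc, Nat.reduceAdd] at h2
    push_cast
    nlinarith

lemma digitValue_nonneg {a : ℕ} (ha : 2 ≤ a) (d : ℕ → ℕ) (k : ℕ) : 0 ≤ digitValue a d k :=
  Finset.sum_nonneg fun i _ => mul_nonneg (by positivity) (by linarith [rauzyNum_pos ha i])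

lemma RauzyDigits.lt {a : ℕ} (ha : 2 ≤ a) {d : ℕ → ℕ} (hd : RauzyDigits a d) (n : ℕ) :
    d n + 1 ≤ a := by
  rcases n with _ | _ | _ | n
  · rw [hd.zero]; omega
  · rw [zero_add, hd.one]; omega
  · exact hd.two
  · show d (n + 3) + 1 ≤ a
    rcases hd.window n with h | h <;> omega

/-- If one of the two top digits falls short of `a - 1`, the digits below it amount to less than one
unit of its place. Otherwise the next two digits vanish, and `rauzyNum_add_four` reduces the claim
to the prefix four places shorter. -/
lemma RauzyDigits.digitValue_lt {a : ℕ} (ha : 2 ≤ a) {d : ℕ → ℕ} (hd : RauzyDigits a d) (k : ℕ) :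
    digitValue a d k < rauzyNum a k := by
  induction k using Nat.strong_induction_on with
  | _ k ih =>
    have ha' : (2 : ℤ) ≤ a := by exact_mod_cast ha
    rcases k with _ | _ | _ | _ | k
    · simp [digitValue_zero, rauzyNum]
    · simp [digitValue, rauzyNum, hd.zero]
    · simp [digitValue, rauzyNum, hd.zero, hd.one, Finset.sum_range_succ]
    · have := hd.two
      simp only [digitValue, Finset.sum_range_succ, hd.zero, hd.one, rauzyNum]
      simp
      omega
    · simp only [add_assoc, Nat.reduceAdd]
      have i1 := ih k (by omega)
      have i2 := ih (k + 2) (by omega)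
      have i3 := ih (k + 3) (by omega)
      have e4 := digitValue_succ a d (k + 3)
      have e3 := digitValue_succ a d (k + 2)
      have e2 := digitValue_succ a d (k + 1)
      have e1 := digitValue_succ a d k
      simp only [add_assoc, Nat.reduceAdd] at e1 e2 e3 e4
      have t := rauzyNum_add_four a k
      have p0 := rauzyNum_pos ha k
      have p2 := rauzyNum_pos ha (k + 2)
      have p3 := rauzyNum_pos ha (k + 3)
      rcases hd.window k with h | ⟨h, h | ⟨h', hz, hw⟩⟩
      · have hx : (d (k + 3) : ℤ) ≤ a - 2 := by omega
        nlinarith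
      · have hx : (d (k + 3) : ℤ) = a - 1 := by omega
        have hy : (d (k + 2) : ℤ) ≤ a - 2 := by omega
        rw [hx] at e4
        nlinarith
      · have hx : (d (k + 3) : ℤ) = a - 1 := by omega
        have hy : (d (k + 2) : ℤ) = a - 1 := by omega
        rw [hx] at e4
        rw [hy] at e3
        rw [hz] at e2
        rw [hw] at e1
        push_cast at e1 e2
        linarith

/-- A window at or above the critical word would already contribute at least `T_{n+4}`, by
`rauzyNum_add_four` and monotonicity. -/
lemma rauzyDigits_of_digitValue_lt {a : ℕ} (ha : 2 ≤ a) {d : ℕ → ℕ} (h0 : d 0 = 0) (h1 : d 1 = 0)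
    (h : ∀ k, digitValue a d k < rauzyNum a k) : RauzyDigits a d := by
  have ha' : (2 : ℤ) ≤ a := by exact_mod_cast ha
  refine ⟨h0, h1, ?_, fun n => ?_⟩
  · have := h 3
    simp [digitValue, Finset.sum_range_succ, h0, h1, rauzyNum] at this
    omega
  · have i1 := h (n + 4)
    have e4 := digitValue_succ a d (n + 3)
    have e3 := digitValue_succ a d (n + 2)
    have e2 := digitValue_succ a d (n + 1)
    have e1 := digitValue_succ a d n
    simp only [add_assoc, Nat.reduceAdd] at e1 e2 e3 e4
    have t := rauzyNum_add_four a n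
    have e0 := digitValue_nonneg ha d n
    have p0 := rauzyNum_pos ha n
    have p1 := rauzyNum_le_succ ha n
    have p2 := rauzyNum_le_succ ha (n + 1)
    have p3 := rauzyNum_le_succ ha (n + 2)
    simp only [add_assoc, Nat.reduceAdd] at p2 p3
    have q1 : 0 ≤ (d (n + 1) : ℤ) * rauzyNum a (n + 1) := by nlinarith
    have q2 : 0 ≤ (d (n + 2) : ℤ) * rauzyNum a (n + 2) := by nlinarith
    have q0 : 0 ≤ (d n : ℤ) * rauzyNum a n := by nlinarith
    by_contra hw
    unfold RauzyWindow at hw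
    rcases lt_trichotomy (d (n + 3) + 1) a with hx | hx | hx
    · omega
    · have hx' : (d (n + 3) : ℤ) = a - 1 := by omega
      rw [hx'] at e4
      rcases lt_trichotomy (d (n + 2) + 1) a with hy | hy | hy
      · omega
      · have hy' : (d (n + 2) : ℤ) = a - 1 := by omega
        rw [hy'] at e3
        by_cases hz : d (n + 1) = 0
        · have : (1 : ℤ) ≤ d n := by omega
          nlinarith
        · have : (1 : ℤ) ≤ d (n + 1) := by omega
          nlinarith
      · have : (a : ℤ) ≤ d (n + 2) := by omega
        nlinarith
    · have : (a : ℤ) ≤ d (n + 3) := by omega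
      have t3 := rauzyNum_add_three a (n + 1)
      simp only [add_assoc, Nat.reduceAdd] at t3
      nlinarith

/-- Every nonnegative integer below `rauzyNum a (k + 2)` is represented by an admissible string
supported on the indices `< k + 2`. -/
lemma exists_rauzyDigits_digitValue {a : ℕ} (ha : 2 ≤ a) (k : ℕ) (N : ℤ) (hN : 0 ≤ N)
    (hNk : N < rauzyNum a (k + 2)) :
    ∃ d : ℕ → ℕ, RauzyDigits a d ∧ (∀ i, k + 2 ≤ i → d i = 0) ∧ digitValue a d (k + 2) = N := by
  -- The induction carries the greedy inequalities, which survive a new top digit more easily than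
  -- the windows do.
  suffices h : ∃ d : ℕ → ℕ, d 0 = 0 ∧ d 1 = 0 ∧ (∀ j, digitValue a d j < rauzyNum a j) ∧
      (∀ i, k + 2 ≤ i → d i = 0) ∧ digitValue a d (k + 2) = N by
    obtain ⟨d, h0, h1, h2, h3, h4⟩ := h
    exact ⟨d, rauzyDigits_of_digitValue_lt ha h0 h1 h2, h3, h4⟩
  induction k generalizing N with
  | zero =>
    have : N = 0 := by simp [rauzyNum] at hNk; omega
    subst this
    refine ⟨fun _ => 0, rfl, rfl, fun j => ?_, fun _ _ => rfl, ?_⟩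
    · have := rauzyNum_pos ha j
      simp [digitValue]
      omega
    · simp [digitValue]
  | succ k ih =>
    have hT := rauzyNum_pos ha (k + 2)
    obtain ⟨d, h0, h1, h2, h3, h4⟩ := ih (N % rauzyNum a (k + 2)) (Int.emod_nonneg _ (by omega))
      (Int.emod_lt_of_pos _ (by omega))
    have hq : 0 ≤ N / rauzyNum a (k + 2) := Int.ediv_nonneg hN (by omega)
    -- Greedy step: the quotient is the new top digit, the remainder was expanded by induction.
    set d' := Function.update d (k + 2) (N / rauzyNum a (k + 2)).toNat with hd'
    have same : ∀ j ≤ k + 2, digitValue a d' j = digitValue a d j := by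
      intro j hj
      refine Finset.sum_congr rfl fun i hi => ?_
      have : i ≠ k + 2 := by have := Finset.mem_range.1 hi; omega
      rw [hd', Function.update_of_ne this]
    have top : digitValue a d' (k + 3) = N := by
      rw [digitValue_succ a d' (k + 2), same _ le_rfl, h4, hd', Function.update_self,
        Int.toNat_of_nonneg hq, mul_comm]
      exact Int.emod_add_mul_ediv N _
    have zero' : ∀ i, k + 3 ≤ i → d' i = 0 := fun i hi => by
      rw [hd', Function.update_of_ne (by omega)]
      exact h3 i (by omega)
    refine ⟨d', ?_, ?_, fun j => ?_, zero', top⟩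
    · rw [hd', Function.update_of_ne (by omega), h0]
    · rw [hd', Function.update_of_ne (by omega), h1]
    · rcases le_or_gt j (k + 2) with hj | hj
      · rw [same j hj]; exact h2 j
      · have : ∀ i, digitValue a d' (k + 3 + i) = N := by
          intro i
          induction i with
          | zero => exact top
          | succ i ihi =>
            rw [← add_assoc, digitValue_succ, ihi, zero' _ (by omega)]
            simp
        obtain ⟨i, rfl⟩ := Nat.exists_eq_add_of_le (show k + 3 ≤ j by omega)
        rw [this]
        exact hNk.trans_le (rauzyNum_mono ha (by omega))

/-! ### Size of `α`, convergence and compactness -/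

lemma list_lt_iff_rauzyWindow {a : ℕ} (ha : 2 ≤ a) (x y z w : ℕ) :
    [x, y, z, w] < [a - 1, a - 1, 0, 1] ↔ RauzyWindow a x y z w := by
  unfold RauzyWindow
  simp only [List.cons_lt_cons_iff, List.lt_irrefl, and_false, or_false]
  omega

/-- Vieta's formulas for the roots `α`, its conjugate and the real root `a - 2 Re α`: the product
and the sum of pairwise products both equal `1`. -/
lemma rauzy_normSq_aux {a : ℕ} {α : ℂ}
    (hα : α ^ 3 - (a : ℂ) * α ^ 2 + α - 1 = 0) (hα_im : α.im ≠ 0) :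
    Complex.normSq α * (a - 2 * α.re) = 1 ∧
      (2 * α.re) ^ 2 - Complex.normSq α - a * (2 * α.re) + 1 = 0 := by
  have hq : α ^ 2 = (2 * α.re : ℝ) * α - (Complex.normSq α : ℝ) := by
    apply Complex.ext <;> simp [Complex.normSq_apply, pow_two] <;> ring
  set t : ℝ := 2 * α.re
  set n : ℝ := Complex.normSq α
  have h : ((t ^ 2 - n - a * t + 1 : ℝ) : ℂ) * α + ((-t * n + a * n - 1 : ℝ) : ℂ) = 0 := by
    push_cast
    linear_combination hα - (α + t - a) * hq
  have him := congrArg Complex.im h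
  rw [Complex.add_im, Complex.im_ofReal_mul, Complex.ofReal_im, add_zero, Complex.zero_im] at him
  have h1 := (mul_eq_zero.1 him).resolve_right hα_im
  rw [h1] at h
  have h2 : -t * n + a * n - 1 = 0 := by
    have := congrArg Complex.re h
    simpa using this
  exact ⟨by linarith, h1⟩

lemma rauzy_norm_lt_one {a : ℕ} (ha : 2 ≤ a) {α : ℂ}
    (hα : α ^ 3 - (a : ℂ) * α ^ 2 + α - 1 = 0) (hα_im : α.im ≠ 0) : ‖α‖ < 1 := by
  obtain ⟨h1, h2⟩ := rauzy_normSq_aux hα hα_im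
  have ha' : (2 : ℝ) ≤ a := by exact_mod_cast ha
  have hn : Complex.normSq α < 1 := by
    set t : ℝ := 2 * α.re
    set n : ℝ := Complex.normSq α
    -- Eliminating `t` leaves `n (a - n + n²) = 1`, impossible for `n ≥ 1` and `a ≥ 2`.
    have h3 : t = n - n ^ 2 := by linear_combination (-n) * h2 - t * h1
    rw [h3] at h1
    by_contra hn
    push Not at hn
    nlinarith [mul_nonneg (sub_nonneg.2 hn) (sub_nonneg.2 hn),
      mul_nonneg (sub_nonneg.2 hn) (sub_nonneg.2 ha')]
  rw [Complex.normSq_eq_norm_sq] at hn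
  nlinarith [norm_nonneg α]

lemma rauzy_ne_zero {α : ℂ} (hα_im : α.im ≠ 0) : α ≠ 0 := fun h => hα_im (by simp [h])

/-- The fractal in terms of digit strings indexed by the natural numbers. -/
lemma mem_rauzyFractal_iff {a : ℕ} (ha : 2 ≤ a) {α z : ℂ} :
    z ∈ rauzyFractal a α ↔
      ∃ d : ℕ → ℕ, RauzyDigits a d ∧ HasSum (fun n => (d n : ℂ) * α ^ n) z := by
  constructor
  · rintro ⟨ε, ⟨h0, hw⟩, hs⟩
    refine ⟨fun n => ε n, ⟨h0 _ (by norm_num), h0 _ (by norm_num), ?_, fun n => ?_⟩, ?_⟩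
    · have := (list_lt_iff_rauzyWindow ha _ _ _ _).1 (hw 2 le_rfl)
      simp only [RauzyWindow] at this
      have : ε 2 < a := by omega
      exact_mod_cast this
    · have := (list_lt_iff_rauzyWindow ha _ _ _ _).1 (hw (n + 3) (by omega))
      convert this using 2 <;> push_cast <;> ring
    · rw [← hasSum_nat_add_iff' 2]
      have e0 : ε ((0 : ℕ) : ℤ) = 0 := h0 _ (by norm_num)
      have e1 : ε ((1 : ℕ) : ℤ) = 0 := h0 _ (by norm_num)
      simpa [Finset.sum_range_succ, e0, e1, h0 0, h0 1] using hs
  · rintro ⟨d, hd, hs⟩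
    refine ⟨fun i => d i.toNat, ⟨fun i hi => ?_, fun i hi => ?_⟩, ?_⟩
    · have : i.toNat = 0 ∨ i.toNat = 1 := by omega
      rcases this with h | h
      · simp [h, hd.zero]
      · simp [h, hd.one]
    · rw [list_lt_iff_rauzyWindow ha]
      rcases hi.eq_or_lt with rfl | hi
      · have := hd.two
        simp [RauzyWindow, hd.zero, hd.one, show (2 : ℤ).toNat = 2 from rfl]
        omega
      · obtain ⟨n, rfl⟩ : ∃ n : ℕ, i = n + 3 := ⟨(i - 3).toNat, by omega⟩
        have := hd.window n
        convert this using 2 <;> omega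
    · rw [← hasSum_nat_add_iff' 2] at hs
      have e : ∀ n : ℕ, ((n : ℤ) + 2).toNat = n + 2 := fun n => by omega
      simpa [Finset.sum_range_succ, hd.zero, hd.one, e] using hs

lemma norm_digit_mul_pow_le {a : ℕ} {d : ℕ → ℕ} (hd : ∀ n, d n + 1 ≤ a) (α : ℂ) (n : ℕ) :
    ‖(d n : ℂ) * α ^ n‖ ≤ a * ‖α‖ ^ n := by
  rw [norm_mul, norm_pow, Complex.norm_natCast]
  gcongr
  have := hd n
  omega

lemma summable_digit_mul_pow {a : ℕ} {d : ℕ → ℕ} (hd : ∀ n, d n + 1 ≤ a) {α : ℂ} (h : ‖α‖ < 1) :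
    Summable fun n => (d n : ℂ) * α ^ n :=
  Summable.of_norm_bounded ((summable_geometric_of_lt_one (norm_nonneg _) h).mul_left _)
    (norm_digit_mul_pow_le hd α)

/-- The fractal is the continuous image of a closed set of strings in the compact product `ℕ → Fin
a`. -/
lemma isCompact_rauzyFractal {a : ℕ} (ha : 2 ≤ a) {α : ℂ} (h : ‖α‖ < 1) :
    IsCompact (rauzyFractal a α) := by
  have hK : IsCompact {d : ℕ → Fin a | RauzyDigits a fun n => d n} := by
    apply IsClosed.isCompact
    have : {d : ℕ → Fin a | RauzyDigits a fun n => d n} =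
        {d | (d 0 : ℕ) = 0} ∩ {d | (d 1 : ℕ) = 0} ∩
          ⋂ n, {d | RauzyWindow a (d (n + 3)) (d (n + 2)) (d (n + 1)) (d n)} := by
      ext d
      simp only [Set.mem_ofPred_eq, Set.mem_inter_iff, Set.mem_iInter]
      exact ⟨fun H => ⟨⟨H.zero, H.one⟩, H.window⟩, fun H => ⟨H.1.1, H.1.2, (d 2).2, H.2⟩⟩
    rw [this]
    have c : ∀ n, Continuous fun d : ℕ → Fin a => d n := fun n => continuous_apply n
    refine IsClosed.inter (IsClosed.inter ?_ ?_) (isClosed_iInter fun n => ?_)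
    · exact (isClosed_discrete {x : Fin a | (x : ℕ) = 0}).preimage (c 0)
    · exact (isClosed_discrete {x : Fin a | (x : ℕ) = 0}).preimage (c 1)
    · exact (isClosed_discrete {x : Fin a × Fin a × Fin a × Fin a |
        RauzyWindow a x.1 x.2.1 x.2.2.1 x.2.2.2}).preimage
        ((c (n + 3)).prodMk ((c (n + 2)).prodMk ((c (n + 1)).prodMk (c n))))
  have hf : Continuous fun d : ℕ → Fin a => ∑' n, ((d n : ℕ) : ℂ) * α ^ n := by
    refine continuous_tsum (fun n => ?_)
      ((summable_geometric_of_lt_one (norm_nonneg _) h).mul_left (a : ℝ))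
      fun n d => norm_digit_mul_pow_le (d := fun n => d n) (fun n => (d n).2) α n
    exact (continuous_of_discreteTopology (f := fun x : Fin a => ((x : ℕ) : ℂ) * α ^ n)).comp
      (continuous_apply n)
  convert hK.image hf using 1
  ext z
  rw [mem_rauzyFractal_iff ha]
  constructor
  · rintro ⟨d, hd, hs⟩
    exact ⟨fun n => ⟨d n, hd.lt ha n⟩, hd, hs.tsum_eq⟩
  · rintro ⟨d, hd, rfl⟩
    exact ⟨_, hd, (summable_digit_mul_pow (hd.lt ha) h).hasSum⟩

/-- The tails of a convergent power series with bounded coefficients are bounded. -/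
lemma bounded_of_hasSum_recursion {α : ℂ} (h : ‖α‖ < 1) (h0 : α ≠ 0) {c w : ℕ → ℂ} {C : ℝ}
    (hc : ∀ n, ‖c n‖ ≤ C) (hs : HasSum (fun n => c n * α ^ n) (w 0))
    (hrec : ∀ n, w n = c n + α * w (n + 1)) (n : ℕ) : ‖w n‖ ≤ C * (1 - ‖α‖)⁻¹ := by
  -- The recursion identifies `w n` with the series shifted by `n` places.
  have key : ∀ n, HasSum (fun i => c (n + i) * α ^ i) (w n) := by
    intro n
    induction n with
    | zero => simpa using hs
    | succ n ih =>
      rw [← hasSum_nat_add_iff' 1] at ih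
      simp only [Finset.sum_range_one, pow_zero, mul_one, add_zero] at ih
      have := ih.mul_left α⁻¹
      rw [show w (n + 1) = α⁻¹ * (w n - c n) by rw [hrec n]; field_simp; ring,
        show (fun i => c (n + 1 + i) * α ^ i) = fun i => α⁻¹ * (c (n + (i + 1)) * α ^ (i + 1)) from ?_]
      · exact this
      · ext i
        rw [pow_succ, add_assoc, add_comm 1 i]
        field_simp
  have hb : ∀ i, ‖c (n + i) * α ^ i‖ ≤ C * ‖α‖ ^ i := by
    intro i
    rw [norm_mul, norm_pow]
    gcongr
    exact hc _
  have hg := (hasSum_geometric_of_lt_one (norm_nonneg α) h).mul_left C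
  rw [← (key n).tsum_eq]
  exact tsum_of_norm_bounded hg hb

/-! ### Integer descent: bounded carries lie in `{-1, 0, 1}` -/

/-- Integer sequences satisfying the two inequalities that hold for the carries produced when two
admissible digit strings represent numbers differing by an element of the lattice. -/
structure CarryBound (a : ℕ) (p : ℕ → ℤ) : Prop where
  value : ∀ j, |p j * rauzyNum a (j + 2) - p (j + 1) * (rauzyNum a (j + 1) - rauzyNum a j) +
    p (j + 2) * rauzyNum a (j + 1)| < rauzyNum a (j + 2)
  digit : ∀ j, |p j - a * p (j + 1) + p (j + 2) - p (j + 3)| ≤ a - 1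

lemma CarryBound.neg {a : ℕ} {p : ℕ → ℤ} (h : CarryBound a p) : CarryBound a (fun j => -p j) := by
  refine ⟨fun j => ?_, fun j => ?_⟩
  · rw [← abs_neg]
    convert h.value j using 2
    ring
  · rw [← abs_neg]
    convert h.digit j using 2
    ring

lemma rauzyNum_four_mul_le {a : ℕ} (ha : 4 ≤ a) (j : ℕ) :
    4 * rauzyNum a (j + 2) - 2 * rauzyNum a (j + 1) ≤ rauzyNum a (j + 3) := by
  rw [rauzyNum_add_three]
  have h1 := rauzyNum_pos (by omega : 2 ≤ a) j
  have h2 := rauzyNum_pos (by omega : 2 ≤ a) (j + 1)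
  have h3 := rauzyNum_pos (by omega : 2 ≤ a) (j + 2)
  have : (4 : ℤ) ≤ a := by exact_mod_cast ha
  nlinarith

lemma rauzyNum_three_ineqs (j : ℕ) :
    rauzyNum 3 (j + 2) ≤ 2 * rauzyNum 3 (j + 1) + 3 * rauzyNum 3 j ∧
      rauzyNum 3 (j + 3) = 3 * rauzyNum 3 (j + 2) - rauzyNum 3 (j + 1) + rauzyNum 3 j := by
  refine ⟨?_, rauzyNum_add_three 3 j⟩
  rcases j with _ | _ | j
  · simp [rauzyNum]
  · simp [rauzyNum]
  · have e1 := rauzyNum_add_three 3 j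
    have e2 := rauzyNum_add_three 3 (j + 1)
    have h1 := rauzyNum_le_succ (a := 3) (by norm_num) j
    have h2 := rauzyNum_le_succ (a := 3) (by norm_num) (j + 1)
    have h0 := rauzyNum_pos (a := 3) (by norm_num) j
    simp only [add_assoc, Nat.reduceAdd, Nat.cast_ofNat] at *
    omega

lemma rauzyNum_two_ineqs (j : ℕ) :
    (rauzyNum 2 (j + 1) ≤ 2 * rauzyNum 2 j ∧
      2 * rauzyNum 2 (j + 2) ≤ rauzyNum 2 (j + 1) + 6 * rauzyNum 2 j ∧
      3 * rauzyNum 2 (j + 2) ≤ 5 * rauzyNum 2 (j + 1) + 2 * rauzyNum 2 j ∧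
      7 * rauzyNum 2 (j + 1) ≤ 2 * rauzyNum 2 (j + 2) + 7 * rauzyNum 2 j) ∧
      rauzyNum 2 (j + 2) ≤ rauzyNum 2 (j + 1) + 2 * rauzyNum 2 j ∧
      2 * rauzyNum 2 (j + 1) ≤ rauzyNum 2 (j + 2) + rauzyNum 2 j ∧
      rauzyNum 2 (j + 3) = 2 * rauzyNum 2 (j + 2) - rauzyNum 2 (j + 1) + rauzyNum 2 j := by
  rcases j with _ | _ | _ | j
  · simp [rauzyNum]
  · simp [rauzyNum]
  · simp [rauzyNum]
  · have e0 := rauzyNum_add_three 2 j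
    have e1 := rauzyNum_add_three 2 (j + 1)
    have e2 := rauzyNum_add_three 2 (j + 2)
    have e3 := rauzyNum_add_three 2 (j + 3)
    have h1 := rauzyNum_le_succ (a := 2) (by norm_num) j
    have h2 := rauzyNum_le_succ (a := 2) (by norm_num) (j + 1)
    have h0 := rauzyNum_pos (a := 2) (by norm_num) j
    simp only [add_assoc, Nat.reduceAdd, Nat.cast_ofNat] at *
    omega

/-- The contraction argument: a bound `M` on the carries improves as long as it is larger than
`1 / (1 - c)`, where `c` bounds `(2 T_{j+2} - T_{j+1}) / T_{j+3}`. -/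
lemma CarryBound.lt_of_contraction {a : ℕ} (ha : 2 ≤ a) {p : ℕ → ℤ} (h : CarryBound a p)
    {r s M : ℤ} (hrs : ∀ j, s * (2 * rauzyNum a (j + 2) - rauzyNum a (j + 1)) ≤
      r * rauzyNum a (j + 3)) (hs : 0 < s) (hM : s ≤ M * (s - r))
    (hp : ∀ j, |p (j + 1)| ≤ M) (j : ℕ) : p (j + 1) < M := by
  have h1 := (abs_lt.1 (h.value (j + 1))).2
  simp only [add_assoc, Nat.reduceAdd] at h1
  have T1 := rauzyNum_pos ha (j + 1)
  have T2 := rauzyNum_le_succ ha (j + 1)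
  have T3 := rauzyNum_le_succ ha (j + 2)
  simp only [add_assoc, Nat.reduceAdd] at T2 T3
  by_contra hc
  -- If `M` were attained, inserting the extreme values `M` and `-M` for the next two carries would
  -- give `M T_{j+3} - M (2 T_{j+2} - T_{j+1}) < T_{j+3}`.
  have hc' : p (j + 1) = M := le_antisymm ((abs_le.1 (hp j)).2) (not_lt.1 hc)
  have hM0 : 0 ≤ M := (abs_nonneg _).trans (hp j)
  have b1 := (abs_le.1 (hp (j + 1))).2
  have b2 := (abs_le.1 (hp (j + 2))).1
  simp only [add_assoc, Nat.reduceAdd] at b1 b2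
  rw [hc'] at h1
  set X := rauzyNum a (j + 1)
  set Y := rauzyNum a (j + 2)
  set Z := rauzyNum a (j + 3)
  have g1 : p (j + 2) * (Y - X) ≤ M * (Y - X) := mul_le_mul_of_nonneg_right b1 (by linarith)
  have g2 : -M * Y ≤ p (j + 3) * Y := mul_le_mul_of_nonneg_right b2 (by linarith)
  have g3 : M * Z - M * (2 * Y - X) < Z := by linarith
  have g4 : M * (s * (2 * Y - X)) ≤ M * (r * Z) := mul_le_mul_of_nonneg_left (hrs j) hM0
  have g5 : s * (M * Z - M * (2 * Y - X)) < s * Z := mul_lt_mul_of_pos_left g3 hs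
  have g6 : s * Z ≤ M * (s - r) * Z := mul_le_mul_of_nonneg_right hM (by linarith)
  linarith

/-- A carry `2` would have to be followed by `2, -2`; the first of these again forces `2, -2`, a
contradiction. -/
lemma CarryBound.ne_two_of_three {p : ℕ → ℤ} (h : CarryBound 3 p) (hp : ∀ j, |p (j + 1)| ≤ 2)
    (j : ℕ) : p (j + 1) ≠ 2 := by
  have step : ∀ j, p (j + 1) = 2 → p (j + 2) = 2 ∧ p (j + 3) = -2 := by
    intro j hj
    have h1 := (abs_lt.1 (h.value (j + 1))).2
    have T0 := rauzyNum_pos (a := 3) (by norm_num) j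
    have T1 := rauzyNum_le_succ (a := 3) (by norm_num) j
    have T2 := rauzyNum_le_succ (a := 3) (by norm_num) (j + 1)
    have T3 := rauzyNum_three_ineqs j
    obtain ⟨b1, b2⟩ := abs_le.1 (hp (j + 1))
    obtain ⟨b3, b4⟩ := abs_le.1 (hp (j + 2))
    simp only [add_assoc, Nat.reduceAdd] at h1 T2 T3 b1 b2 b3 b4
    rw [hj] at h1
    generalize p (j + 2) = x at *
    generalize p (j + 3) = y at *
    interval_cases x <;> interval_cases y <;> first | exact ⟨rfl, rfl⟩ | omega
  intro hj
  have := step j hj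
  have := step (j + 1) this.1
  simp only [add_assoc, Nat.reduceAdd] at this
  omega

/-- For `a = 2` the contraction is too weak below `7`. Attaining the maximum still nearly determines
the next two carries, through the value inequality and linear bounds on ratios of the base. -/
lemma CarryBound.step_of_two {p : ℕ → ℤ} (h : CarryBound 2 p) {m : ℤ}
    (hp : ∀ j, |p (j + 1)| ≤ m) (j : ℕ) (hj : p (j + 1) = m) :
    (m = 6 → p (j + 2) = 6 ∧ p (j + 3) = -6) ∧
    (m = 5 → 4 ≤ p (j + 2) ∧ p (j + 3) = -5) ∧
    (m = 4 → 3 ≤ p (j + 2) ∧ p (j + 3) = -4) ∧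
    (m = 3 → 2 ≤ p (j + 2) ∧ p (j + 3) = -3) ∧
    (m = 2 → (0 ≤ p (j + 2) ∧ p (j + 3) = -2) ∨ (p (j + 2) = 2 ∧ p (j + 3) = -1)) := by
  have h1 := (abs_lt.1 (h.value (j + 1))).2
  have T0 := rauzyNum_pos (a := 2) (by norm_num) j
  have T1 := rauzyNum_le_succ (a := 2) (by norm_num) j
  have T2 := rauzyNum_le_succ (a := 2) (by norm_num) (j + 1)
  obtain ⟨⟨T3, T4, T5, T6⟩, T7, T8, T9⟩ := rauzyNum_two_ineqs j
  obtain ⟨b1, b2⟩ := abs_le.1 (hp (j + 1))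
  obtain ⟨b3, b4⟩ := abs_le.1 (hp (j + 2))
  simp only [add_assoc, Nat.reduceAdd] at h1 T2 b1 b2 b3 b4
  rw [hj] at h1
  generalize p (j + 2) = x at *
  generalize p (j + 3) = y at *
  refine ⟨?_, ?_, ?_, ?_, ?_⟩ <;> rintro rfl <;>
    interval_cases x <;> interval_cases y <;> omega

/-- The second step of the descent, where the bound on the carries need not be attained. -/
lemma CarryBound.step_of_two' {p : ℕ → ℤ} (h : CarryBound 2 p) {m : ℤ}
    (hp : ∀ j, |p (j + 1)| ≤ m) (j : ℕ) :
    (m = 5 → p (j + 2) = 4 → p (j + 3) ≠ -5) ∧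
    (m = 4 → p (j + 2) = 3 → p (j + 3) ≠ -4) ∧
    (m = 3 → p (j + 2) = 2 → p (j + 3) ≠ -3) ∧
    (m = 2 → p (j + 2) = 2 → p (j + 3) ≠ -1) := by
  have h1 := (abs_lt.1 (h.value (j + 2))).2
  have T0 := rauzyNum_pos (a := 2) (by norm_num) j
  have T1 := rauzyNum_le_succ (a := 2) (by norm_num) j
  have T2 := rauzyNum_le_succ (a := 2) (by norm_num) (j + 1)
  obtain ⟨⟨T3, T4, T5, T6⟩, T7, T8, T9⟩ := rauzyNum_two_ineqs j
  have T10 := (rauzyNum_two_ineqs (j + 1)).2.2.2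
  obtain ⟨b3, b4⟩ := abs_le.1 (hp (j + 3))
  simp only [add_assoc, Nat.reduceAdd] at h1 T2 T10 b3 b4
  generalize p (j + 4) = z at *
  refine ⟨?_, ?_, ?_, ?_⟩ <;> rintro rfl h2 h3 <;> rw [h2, h3] at h1 <;>
    interval_cases z <;> omega

/-- The maximum `m` is followed by `x, -m` with `x` equal to `m` or `m - 1`. The first contradicts
`step_of_two` one place later, the second contradicts `step_of_two'`. -/
lemma CarryBound.ne_of_two {p : ℕ → ℤ} (h : CarryBound 2 p) {m : ℤ} (hm : 3 ≤ m) (hm' : m ≤ 6)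
    (hp : ∀ j, |p (j + 1)| ≤ m) (j : ℕ) : p (j + 1) ≠ m := by
  intro hj
  have s1 := h.step_of_two hp j hj
  have s2 := h.step_of_two hp (j + 1)
  have s3 := h.step_of_two' hp j
  obtain ⟨b', b⟩ := abs_le.1 (hp (j + 1))
  simp only [add_assoc, Nat.reduceAdd] at s2 b b'
  generalize p (j + 2) = x at *
  generalize p (j + 3) = y at *
  interval_cases m <;> simp at s1 s3 <;> interval_cases x <;> simp_all

/-- A carry `2` starts a pattern `2, x, -2, y, 2, z, -2` with `x, z ∈ {0, 1}` and `y ∈ {-1, 0}`.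
Four consecutive digit inequalities then force `x = 0`, `y = -1`, `z = 1` and also `y + z ≥ 1`. -/
lemma CarryBound.ne_two_of_two {p : ℕ → ℤ} (h : CarryBound 2 p) (hp : ∀ j, |p (j + 1)| ≤ 2)
    (j : ℕ) : p (j + 1) ≠ 2 := by
  have step : ∀ p : ℕ → ℤ, CarryBound 2 p → (∀ j, |p (j + 1)| ≤ 2) → ∀ j, p (j + 1) = 2 →
      0 ≤ p (j + 2) ∧ p (j + 2) ≤ 1 ∧ p (j + 3) = -2 := by
    intro p h hp j hj
    have s1 := (h.step_of_two hp j hj).2.2.2.2 rfl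
    have s2 := fun hx => (h.step_of_two hp (j + 1) hx).2.2.2.2 rfl
    have s3 := (h.step_of_two' hp j).2.2.2 rfl
    have b := (abs_le.1 (hp (j + 1))).2
    simp only [add_assoc, Nat.reduceAdd] at s2 b
    by_cases hx : p (j + 2) = 2
    · have := s2 hx
      have := s3 hx
      omega
    · omega
  have hp' : ∀ j, |(fun j => -p j) (j + 1)| ≤ 2 := fun j => by simpa using hp j
  intro hj
  have s1 := step p h hp j hj
  have s2 := step _ h.neg hp' (j + 2)
  have s3 := step p h hp (j + 4)
  have d1 := h.digit (j + 1)
  have d2 := h.digit (j + 2)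
  have d3 := h.digit (j + 3)
  have d4 := h.digit (j + 4)
  simp only [add_assoc, Nat.reduceAdd, abs_le, Nat.cast_ofNat] at *
  have s2' := s2 (by omega)
  have s3' := s3 (by omega)
  omega

lemma forall_abs_le_one_of_descent {p : ℕ → ℤ} {C : ℤ} (hC : ∀ j, |p (j + 1)| ≤ C)
    (hd : ∀ M : ℤ, 2 ≤ M → (∀ j, |p (j + 1)| ≤ M) → ∀ j, |p (j + 1)| < M) (j : ℕ) :
    |p (j + 1)| ≤ 1 := by
  -- Each round lowers the bound by one until it reaches `1`.
  have key : ∀ n : ℕ, ∀ j, |p (j + 1)| ≤ max 1 (C - n) := by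
    intro n
    induction n with
    | zero => intro j; simp [hC j]
    | succ n ih =>
      intro j
      rcases le_or_gt (max 1 (C - n)) 1 with h1 | h1
      · exact (ih j).trans (h1.trans (le_max_left _ _))
      · have := hd _ (by omega) ih j
        push_cast
        omega
  have := key C.toNat j
  omega

theorem CarryBound.abs_le_one {a : ℕ} (ha : 2 ≤ a) {p : ℕ → ℤ} (h : CarryBound a p) {C : ℤ}
    (hC : ∀ j, |p j| ≤ C) (j : ℕ) : |p j| ≤ 1 := by
  have main : ∀ j, |p (j + 1)| ≤ 1 := by
    refine forall_abs_le_one_of_descent (fun j => hC (j + 1)) fun M hM hp => ?_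
    have hp' : ∀ j, |(fun j => -p j) (j + 1)| ≤ M := fun j => by simpa using hp j
    suffices ∀ q, CarryBound a q → (∀ j, |q (j + 1)| ≤ M) → ∀ j, q (j + 1) < M by
      intro j
      have h1 := this p h hp j
      have h2 : -p (j + 1) < M := this _ h.neg hp' j
      exact abs_lt.2 ⟨by omega, h1⟩
    intro q hq hqM j
    have hle := (abs_le.1 (hqM j)).2
    -- The contraction ratios `6/7`, `3/5`, `1/2` for `a = 2`, `a = 3`, `a ≥ 4` settle `M ≥ 7`, `M ≥
    -- 3`, `M ≥ 2`; the case analyses above cover the smaller `M`.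
    rcases (show a = 2 ∨ a = 3 ∨ 4 ≤ a by omega) with rfl | rfl | ha4
    · rcases (show 7 ≤ M ∨ M = 2 ∨ 3 ≤ M ∧ M ≤ 6 by omega) with h7 | rfl | ⟨h3, h6⟩
      · refine hq.lt_of_contraction le_rfl (r := 6) (s := 7) (fun j => ?_) (by norm_num)
          (by omega) hqM j
        have := rauzyNum_two_ineqs j
        omega
      · exact lt_of_le_of_ne hle (hq.ne_two_of_two hqM j)
      · exact lt_of_le_of_ne hle (hq.ne_of_two h3 h6 hqM j)
    · rcases (show 3 ≤ M ∨ M = 2 by omega) with h3 | rfl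
      · refine hq.lt_of_contraction (by norm_num) (r := 3) (s := 5) (fun j => ?_) (by norm_num)
          (by omega) hqM j
        have := rauzyNum_three_ineqs j
        omega
      · exact lt_of_le_of_ne hle (hq.ne_two_of_three hqM j)
    · refine hq.lt_of_contraction ha (r := 1) (s := 2) (fun j => ?_) (by norm_num)
        (by omega) hqM j
      have := rauzyNum_four_mul_le ha4 j
      omega
  rcases j with _ | j
  -- All base values involved are `1`, so the middle term vanishes and `|p 0 + p 2| < 1`.
  · have h0 := h.value 0
    have h2 := main 1
    simp [rauzyNum] at h0
    rw [show p 0 = -p 2 by omega, abs_neg]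
    exact h2
  · exact main j

/-! ### Carries between two expansions -/

/-- The sequence of carries with start `(-n, m, n)` and digit differences `δ`. -/
def carrySeq (a : ℕ) (m n : ℤ) (δ : ℕ → ℤ) : ℕ → ℤ
  | 0 => -n
  | 1 => m
  | 2 => n
  | j + 3 => carrySeq a m n δ j - a * carrySeq a m n δ (j + 1) + carrySeq a m n δ (j + 2) - δ j

/-- This is the counterpart, under the coordinate sum, of `carrySeq_recursion`. Both sides start at
`0`, as lattice vectors have coordinate sum zero. -/
lemma carrySeq_value {a : ℕ} (m n : ℤ) (d d' : ℕ → ℕ) (h0 : d 0 = 0) (h1 : d 1 = 0)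
    (h0' : d' 0 = 0) (h1' : d' 1 = 0) (j : ℕ) :
    letI p := carrySeq a m n fun j => (d' (j + 2) : ℤ) - d (j + 2)
    p j * rauzyNum a (j + 2) - p (j + 1) * (rauzyNum a (j + 1) - rauzyNum a j) +
      p (j + 2) * rauzyNum a (j + 1) = digitValue a d (j + 2) - digitValue a d' (j + 2) := by
  set p := carrySeq a m n fun j => (d' (j + 2) : ℤ) - d (j + 2)
  induction j with
  | zero =>
    simp [p, carrySeq, rauzyNum, digitValue, Finset.sum_range_succ, h0, h1, h0', h1']
  | succ j ih =>
    have e : p (j + 3) = p j - a * p (j + 1) + p (j + 2) - ((d' (j + 2) : ℤ) - d (j + 2)) := by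
      simp only [p]; rw [carrySeq]
    have t := rauzyNum_add_three a j
    have v := digitValue_succ a d (j + 2)
    have v' := digitValue_succ a d' (j + 2)
    simp only [add_assoc, Nat.reduceAdd] at *
    rw [v, v', e, t]
    linear_combination ih

lemma carrySeq_recursion {a : ℕ} {α : ℂ} (hα : α ^ 3 - (a : ℂ) * α ^ 2 + α - 1 = 0) (m n : ℤ)
    (δ : ℕ → ℤ) (j : ℕ) :
    letI p := carrySeq a m n δ
    α ^ 2 * (p j : ℂ) + (1 - α) * p (j + 1) + α * p (j + 2) = α ^ 2 * δ j +
      α * (α ^ 2 * (p (j + 1) : ℂ) + (1 - α) * p (j + 1 + 1) + α * p (j + 1 + 2)) := by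
  show _ = α ^ 2 * δ j + α * (_ + α * carrySeq a m n δ (j + 3))
  rw [carrySeq]
  push_cast
  linear_combination (-(carrySeq a m n δ (j + 1) : ℂ)) * hα

lemma bounded_of_le_mul_add {q : ℕ → ℝ} {r D : ℝ} (hr : r < 1) (hr0 : 0 ≤ r)
    (h : ∀ j, q (j + 1) ≤ r * q j + D) (j : ℕ) : q j ≤ max (q 0) (D / (1 - r)) := by
  induction j with
  | zero => exact le_max_left _ _
  | succ j ih =>
    have h1 : 0 < 1 - r := by linarith
    set K := max (q 0) (D / (1 - r))
    have h2 : D ≤ K * (1 - r) := (div_le_iff₀ h1).1 (le_max_right _ _)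
    nlinarith [h j, mul_le_mul_of_nonneg_left ih hr0]

/-- After division by `α²` the coefficient of `p j` is `1`, so imaginary parts eliminate `p j`. What
remains is a recursion for `p (j + 2)` in terms of `p (j + 1)` with factor `‖α‖² < 1`. -/
lemma exists_bound_of_norm_bound {a : ℕ} (ha : 2 ≤ a) {α : ℂ}
    (hα : α ^ 3 - (a : ℂ) * α ^ 2 + α - 1 = 0) (hα_im : α.im ≠ 0) {p : ℕ → ℤ} {C : ℝ}
    (h : ∀ j, ‖α ^ 2 * (p j : ℂ) + (1 - α) * p (j + 1) + α * p (j + 2)‖ ≤ C) :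
    ∃ K : ℤ, ∀ j, |p j| ≤ K := by
  have h0 : α ≠ 0 := rauzy_ne_zero hα_im
  have hn1 := rauzy_norm_lt_one ha hα hα_im
  have hn0 : 0 < ‖α‖ := norm_pos_iff.2 h0
  have him : 0 < |α.im| := abs_pos.2 hα_im
  have key : ∀ j, |(p (j + 2) : ℝ)| ≤ ‖α‖ ^ 2 * |(p (j + 1) : ℝ)| + C / |α.im| := by
    intro j
    -- The cubic equation gives `(1 - α) / α² = α - a`.
    have e : (α ^ 2 * (p j : ℂ) + (1 - α) * p (j + 1) + α * p (j + 2)) / α ^ 2 =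
        p j + (p (j + 1) : ℝ) * (α - a) + (p (j + 2) : ℝ) * α⁻¹ := by
      field_simp
      push_cast
      linear_combination (-(p (j + 1) : ℂ)) * hα
    have e' := congrArg Complex.im e
    have i1 : (p (j + 2) * α⁻¹.im : ℝ) = -(p (j + 2) * α.im / ‖α‖ ^ 2) := by
      rw [Complex.inv_im, Complex.normSq_eq_norm_sq]; ring
    rw [Complex.add_im, Complex.add_im, Complex.im_ofReal_mul, Complex.im_ofReal_mul,
      Complex.sub_im, Complex.natCast_im, Complex.intCast_im, i1] at e'
    have b : |((α ^ 2 * (p j : ℂ) + (1 - α) * p (j + 1) + α * p (j + 2)) / α ^ 2).im| ≤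
        C / ‖α‖ ^ 2 := by
      refine (Complex.abs_im_le_norm _).trans ?_
      rw [norm_div, norm_pow]
      gcongr
      exact h j
    rw [e'] at b
    have e2 : (p (j + 2) : ℝ) = ‖α‖ ^ 2 * p (j + 1) - ‖α‖ ^ 2 / α.im *
        (0 + p (j + 1) * (α.im - 0) + -(p (j + 2) * α.im / ‖α‖ ^ 2)) := by
      field_simp
      ring
    rw [e2]
    refine (abs_sub _ _).trans ?_
    rw [abs_mul, abs_mul, abs_div, abs_of_pos (by positivity : 0 < ‖α‖ ^ 2)]
    gcongr
    calc _ ≤ ‖α‖ ^ 2 / |α.im| * (C / ‖α‖ ^ 2) := by gcongr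
      _ = _ := by field_simp
  obtain ⟨B, hB⟩ : ∃ B : ℝ, ∀ j, |(p (j + 1) : ℝ)| ≤ B :=
    ⟨_, bounded_of_le_mul_add (q := fun j => |(p (j + 1) : ℝ)|) (by nlinarith) (by positivity) key⟩
  refine ⟨max |p 0| ⌈B⌉, fun j => ?_⟩
  rcases j with _ | j
  · exact le_max_left _ _
  · refine le_trans ?_ (le_max_right _ _)
    have := (hB j).trans (Int.le_ceil B)
    exact_mod_cast this

/-- If two admissible strings represent numbers differing by a lattice vector, the carries are
bounded by `1`. -/
theorem exists_carries {a : ℕ} (ha : 2 ≤ a) {α : ℂ}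
    (hα : α ^ 3 - (a : ℂ) * α ^ 2 + α - 1 = 0) (hα_im : α.im ≠ 0) {d d' : ℕ → ℕ}
    (hd : RauzyDigits a d) (hd' : RauzyDigits a d') {z z' : ℂ}
    (hz : HasSum (fun n => (d n : ℂ) * α ^ n) z) (hz' : HasSum (fun n => (d' n : ℂ) * α ^ n) z')
    {m n : ℤ} (hv : z = m * (α - 1) + n * (α * (α - 1)) + z') :
    ∃ p : ℕ → ℤ, p 0 = -n ∧ p 1 = m ∧ p 2 = n ∧ (∀ j, |p j| ≤ 1) ∧ CarryBound a p ∧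
      ∀ j, (d' (j + 2) : ℤ) - d (j + 2) = p j - a * p (j + 1) + p (j + 2) - p (j + 3) := by
  set δ : ℕ → ℤ := fun j => (d' (j + 2) : ℤ) - d (j + 2) with hδ
  set p := carrySeq a m n δ with hp
  have hstep : ∀ j, (d' (j + 2) : ℤ) - d (j + 2) = p j - a * p (j + 1) + p (j + 2) - p (j + 3) := by
    intro j
    have : p (j + 3) = p j - a * p (j + 1) + p (j + 2) - δ j := by rw [hp, carrySeq]
    rw [this, hδ]
    ring
  have hlt := hd.lt ha
  have hlt' := hd'.lt ha
  have hδa : ∀ j, |δ j| ≤ a - 1 := by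
    intro j
    have := hlt (j + 2)
    have := hlt' (j + 2)
    rw [abs_le, hδ]
    constructor <;> simp only <;> omega
  have hcb : CarryBound a p := by
    refine ⟨fun j => ?_, fun j => ?_⟩
    · rw [carrySeq_value m n d d' hd.zero hd.one hd'.zero hd'.one j, abs_lt]
      have h1 := hd.digitValue_lt ha (j + 2)
      have h2 := hd'.digitValue_lt ha (j + 2)
      have h3 := digitValue_nonneg ha d (j + 2)
      have h4 := digitValue_nonneg ha d' (j + 2)
      constructor <;> linarith
    · rw [← hstep j]
      exact hδa j
  have hn1 := rauzy_norm_lt_one ha hα hα_im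
  have hbound := bounded_of_hasSum_recursion hn1 (rauzy_ne_zero hα_im)
    (c := fun j => α ^ 2 * δ j)
    (w := fun j => α ^ 2 * (p j : ℂ) + (1 - α) * p (j + 1) + α * p (j + 2)) (C := a)
    (fun j => by
      rw [norm_mul, norm_pow, Complex.norm_intCast]
      have h1 : |(δ j : ℝ)| ≤ a - 1 := by exact_mod_cast hδa j
      have h2 : ‖α‖ ^ 2 ≤ 1 := pow_le_one₀ (norm_nonneg _) hn1.le
      nlinarith [abs_nonneg (δ j : ℝ), norm_nonneg α])
    (by
      have hs := hz'.sub hz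
      rw [← hasSum_nat_add_iff' 2] at hs
      have e1 : (fun j => α ^ 2 * (δ j : ℂ) * α ^ j) =
          fun j => (d' (j + 2) : ℂ) * α ^ (j + 2) - (d (j + 2) : ℂ) * α ^ (j + 2) := by
        ext j
        simp only [hδ]
        push_cast
        ring
      -- The start `(-n, m, n)` is chosen so that the zeroth tail is `z' - z`.
      have e2 : α ^ 2 * (p 0 : ℂ) + (1 - α) * p (0 + 1) + α * p (0 + 2) =
          z' - z - ∑ i ∈ Finset.range 2, ((d' i : ℂ) * α ^ i - (d i : ℂ) * α ^ i) := by
        simp [hp, carrySeq, hd.zero, hd.one, hd'.zero, hd'.one, Finset.sum_range_succ, hv]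
        ring
      simp only [e1, e2]
      exact hs)
    (carrySeq_recursion hα m n δ)
  obtain ⟨K, hK⟩ := exists_bound_of_norm_bound ha hα hα_im hbound
  exact ⟨p, by rw [hp, carrySeq], by rw [hp, carrySeq], by rw [hp, carrySeq],
    hcb.abs_le_one ha hK, hcb, hstep⟩

/-- Zero states propagate backwards: when the two later carries vanish, the value inequality reads
`|p j| T_{j+2} < T_{j+2}`. -/
lemma CarryBound.eq_zero_of_le {a : ℕ} {p : ℕ → ℤ} (h : CarryBound a p) (j : ℕ) (h0 : p j = 0)
    (h1 : p (j + 1) = 0) (h2 : p (j + 2) = 0) : p 0 = 0 ∧ p 1 = 0 ∧ p 2 = 0 := by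
  induction j with
  | zero => exact ⟨h0, h1, h2⟩
  | succ j ih =>
    refine ih ?_ h0 h1
    have hv := h.value j
    rw [h0, h1] at hv
    simp only [zero_mul, sub_zero, add_zero, abs_mul] at hv
    by_contra hne
    have : 1 ≤ |p j| := Int.one_le_abs hne
    have h3 := le_abs_self (rauzyNum a (j + 2))
    have h4 := abs_nonneg (rauzyNum a (j + 2))
    nlinarith

/-! ### The covering -/

/-- `x` is an element of `ℤ[α]` with coordinate sum `N` in the basis `1, α, α²`. -/
def IntegralRep (α x : ℂ) (N : ℤ) : Prop :=
  ∃ c₀ c₁ c₂ : ℤ, x = c₀ + c₁ * α + c₂ * α ^ 2 ∧ c₀ + c₁ + c₂ = N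

lemma IntegralRep.add {α x y : ℂ} {M N : ℤ} (hx : IntegralRep α x M) (hy : IntegralRep α y N) :
    IntegralRep α (x + y) (M + N) := by
  obtain ⟨a, b, c, rfl, rfl⟩ := hx
  obtain ⟨a', b', c', rfl, rfl⟩ := hy
  exact ⟨a + a', b + b', c + c', by push_cast; ring, by ring⟩

lemma IntegralRep.int_mul {α x : ℂ} {N : ℤ} (k : ℤ) (hx : IntegralRep α x N) :
    IntegralRep α (k * x) (k * N) := by
  obtain ⟨a, b, c, rfl, rfl⟩ := hx
  exact ⟨k * a, k * b, k * c, by push_cast; ring, by ring⟩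

lemma IntegralRep.mem_latticeSpan {α x : ℂ} (hx : IntegralRep α x 0) :
    x ∈ latticeSpan (α - 1) (α * (α - 1)) := by
  obtain ⟨a, b, c, rfl, h⟩ := hx
  have : (a : ℂ) + b + c = 0 := by exact_mod_cast h
  exact ⟨-a, c, by push_cast; linear_combination α * this⟩

lemma integralRep_pow {a : ℕ} {α : ℂ} (hα : α ^ 3 - (a : ℂ) * α ^ 2 + α - 1 = 0) (n : ℕ) :
    IntegralRep α (α ^ n) (rauzyNum a n) ∧ IntegralRep α (α ^ (n + 1)) (rauzyNum a (n + 1)) ∧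
      IntegralRep α (α ^ (n + 2)) (rauzyNum a (n + 2)) := by
  induction n with
  | zero =>
    exact ⟨⟨1, 0, 0, by simp, rfl⟩, ⟨0, 1, 0, by simp, rfl⟩, ⟨0, 0, 1, by simp, rfl⟩⟩
  | succ n ih =>
    obtain ⟨h0, h1, h2⟩ := ih
    refine ⟨h1, h2, ?_⟩
    have := ((h2.int_mul a).add (h1.int_mul (-1))).add h0
    convert this using 1
    · push_cast
      linear_combination α ^ n * hα
    · rw [show n + 1 + 2 = n + 3 from rfl, rauzyNum_add_three]
      ring

lemma integralRep_digits {a : ℕ} {α : ℂ} (hα : α ^ 3 - (a : ℂ) * α ^ 2 + α - 1 = 0) (d : ℕ → ℕ)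
    (k : ℕ) : IntegralRep α (∑ i ∈ Finset.range k, (d i : ℂ) * α ^ i) (digitValue a d k) := by
  induction k with
  | zero => exact ⟨0, 0, 0, by simp, by simp [digitValue]⟩
  | succ k ih =>
    rw [Finset.sum_range_succ, digitValue_succ]
    exact ih.add (by exact_mod_cast (integralRep_pow hα k).1.int_mul (d k))

lemma exists_norm_sub_add_mul_le {α : ℂ} (hα_im : α.im ≠ 0) (z : ℂ) :
    ∃ m n : ℤ, ‖(m : ℂ) + n * α - z‖ ≤ 1 + ‖α‖ := by
  set s := z.im / α.im
  set r := z.re - s * α.re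
  have hz : z = r + s * α := by
    apply Complex.ext <;> simp [r, s]
    field_simp
  refine ⟨⌊r⌋, ⌊s⌋, ?_⟩
  have h : ∀ x : ℝ, |(⌊x⌋ : ℝ) - x| ≤ 1 := fun x =>
    abs_le.2 ⟨by linarith [Int.lt_floor_add_one x], by linarith [Int.floor_le x]⟩
  have e : (⌊r⌋ : ℂ) + ⌊s⌋ * α - z = ((⌊r⌋ - r : ℝ) : ℂ) + ((⌊s⌋ - s : ℝ) : ℂ) * α := by
    rw [hz]
    push_cast
    ring
  rw [e]
  refine (norm_add_le _ _).trans ?_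
  rw [norm_mul, Complex.norm_real, Complex.norm_real]
  exact add_le_add (h r) (mul_le_of_le_one_left (norm_nonneg _) (h s))

/-- The elements of `ℤ[α]` with nonnegative coordinate sum are dense in the plane. -/
lemma exists_integralRep_near {a : ℕ} (ha : 2 ≤ a) {α : ℂ}
    (hα : α ^ 3 - (a : ℂ) * α ^ 2 + α - 1 = 0) (hα_im : α.im ≠ 0) (z : ℂ) {ε : ℝ} (hε : 0 < ε) :
    ∃ x N, 0 ≤ N ∧ IntegralRep α x N ∧ ‖x - z‖ < ε := by
  have h1 := rauzy_norm_lt_one ha hα hα_im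
  have h0 := rauzy_ne_zero hα_im
  have htend : Filter.Tendsto (fun n : ℕ => ‖α‖ ^ n * 2) Filter.atTop (nhds 0) := by
    simpa using (tendsto_pow_atTop_nhds_zero_of_lt_one (norm_nonneg α) h1).mul_const 2
  have hev := htend.eventually (gt_mem_nhds (half_pos hε))
  obtain ⟨k, hk⟩ := hev.exists
  -- `ℤ + ℤα` comes within `1 + ‖α‖ < 2` of every point, so multiplying by `α ^ k` gives a fine
  -- approximation. A further `α ^ l` with `l` large makes the coordinate sum nonnegative at
  -- negligible cost.
  obtain ⟨m, n, hmn⟩ := exists_norm_sub_add_mul_le hα_im (z / α ^ k)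
  have hx : IntegralRep α (α ^ k * (m + n * α)) (m * rauzyNum a k + n * rauzyNum a (k + 1)) := by
    have := ((integralRep_pow hα k).1.int_mul m).add ((integralRep_pow hα k).2.1.int_mul n)
    convert this using 1
    ring
  set N := m * rauzyNum a k + n * rauzyNum a (k + 1)
  obtain ⟨l, hl, hl'⟩ := (hev.and (Filter.eventually_ge_atTop (N.natAbs + 2))).exists
  refine ⟨_, _, ?_, hx.add (integralRep_pow hα l).1, ?_⟩
  · obtain ⟨l, rfl⟩ := Nat.exists_eq_add_of_le' (show 2 ≤ l by omega)
    have := le_rauzyNum ha l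
    omega
  · have e : α ^ k * (m + n * α) + α ^ l - z = α ^ k * (m + n * α - z / α ^ k) + α ^ l := by
      field_simp
      ring
    rw [e]
    refine (norm_add_le _ _).trans_lt ?_
    rw [norm_mul, norm_pow, norm_pow]
    have hp : 0 ≤ ‖α‖ ^ l := by positivity
    have : ‖α‖ ^ k * ‖(m : ℂ) + n * α - z / α ^ k‖ ≤ ‖α‖ ^ k * 2 := by
      gcongr
      linarith
    linarith

/-- Subtracting the greedy expansion of `N` leaves coordinate sum `0`, hence a lattice vector. -/
lemma exists_rauzyDigits_of_integralRep {a : ℕ} (ha : 2 ≤ a) {α : ℂ}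
    (hα : α ^ 3 - (a : ℂ) * α ^ 2 + α - 1 = 0) {x : ℂ} {N : ℤ} (hN : 0 ≤ N)
    (hx : IntegralRep α x N) :
    ∃ v ∈ latticeSpan (α - 1) (α * (α - 1)), ∃ y ∈ rauzyFractal a α, x = v + y := by
  obtain ⟨d, hd, hd0, hdN⟩ := exists_rauzyDigits_digitValue ha N.toNat N hN
    (by have := le_rauzyNum ha N.toNat; omega)
  have hy := integralRep_digits hα d (N.toNat + 2)
  rw [hdN] at hy
  refine ⟨x + ((-1 : ℤ) : ℂ) * ∑ i ∈ Finset.range (N.toNat + 2), (d i : ℂ) * α ^ i, ?_,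
    ∑ i ∈ Finset.range (N.toNat + 2), (d i : ℂ) * α ^ i, ?_, by push_cast; ring⟩
  · apply IntegralRep.mem_latticeSpan
    convert hx.add (hy.int_mul (-1)) using 1
    ring
  · rw [mem_rauzyFractal_iff ha]
    refine ⟨d, hd, hasSum_sum_of_ne_finset_zero fun i hi => ?_⟩
    rw [hd0 i (by simpa using hi)]
    simp

lemma latticeSpan_eq {α : ℂ} (m n : ℤ) :
    (m : ℂ) * (α - 1) + n * (α * (α - 1)) = (m + n * α) * (α - 1) := by ring

lemma finite_latticeSpan_inter_closedBall {α : ℂ} (hα_im : α.im ≠ 0) (C : ℝ) :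
    {v | v ∈ latticeSpan (α - 1) (α * (α - 1)) ∧ ‖v‖ ≤ C}.Finite := by
  have hu : α - 1 ≠ 0 := fun h => hα_im (by rw [sub_eq_zero.1 h]; simp)
  have hu' : 0 < ‖α - 1‖ := norm_pos_iff.2 hu
  have him : 0 < |α.im| := abs_pos.2 hα_im
  set D := C / ‖α - 1‖
  set K : ℤ := ⌈D / |α.im|⌉
  set K' : ℤ := ⌈D + K * ‖α‖⌉
  refine (((Set.finite_Icc (-K') K').prod (Set.finite_Icc (-K) K)).image
    fun p : ℤ × ℤ => (p.1 : ℂ) * (α - 1) + p.2 * (α * (α - 1))).subset ?_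
  rintro _ ⟨⟨m, n, rfl⟩, hC⟩
  refine ⟨(m, n), ?_, rfl⟩
  rw [latticeSpan_eq, norm_mul, ← le_div_iff₀ hu'] at hC
  have hn : |(n : ℝ)| ≤ K := by
    refine le_trans ?_ (Int.le_ceil _)
    rw [le_div_iff₀ him, ← abs_mul]
    refine le_trans ?_ hC
    simpa using Complex.abs_im_le_norm ((m : ℂ) + n * α)
  have hm : |(m : ℝ)| ≤ K' := by
    refine le_trans ?_ (Int.le_ceil _)
    have e : (m : ℂ) = (m + n * α) - n * α := by ring
    have : ‖(m : ℂ)‖ ≤ D + K * ‖α‖ := by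
      rw [e]
      refine (norm_sub_le _ _).trans (add_le_add hC ?_)
      rw [norm_mul, Complex.norm_intCast]
      gcongr
    rwa [Complex.norm_intCast] at this
  have hm' : |m| ≤ K' := by exact_mod_cast hm
  have hn' : |n| ≤ K := by exact_mod_cast hn
  exact ⟨abs_le.1 hm', abs_le.1 hn'⟩

lemma isClosed_biUnion_vadd {T F : Set ℂ} (hT : IsClosed T) (hF : F.Finite) :
    IsClosed (⋃ v ∈ F, (v +ᵥ T)) :=
  hF.isClosed_biUnion fun v _ => hT.vadd v

lemma exists_finite_translates {T L : Set ℂ} (hT : IsCompact T)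
    (hL : ∀ C : ℝ, {v | v ∈ L ∧ ‖v‖ ≤ C}.Finite) (z : ℂ) :
    ∃ F ⊆ L, F.Finite ∧ ∀ x, ‖x - z‖ < 1 → ∀ v ∈ L, x ∈ v +ᵥ T → v ∈ F := by
  obtain ⟨B, hB⟩ := hT.isBounded.exists_norm_le
  refine ⟨_, fun v hv => hv.1, hL (‖z‖ + 1 + B), fun x hx v hv hxv => ⟨hv, ?_⟩⟩
  obtain ⟨t, ht, rfl⟩ := hxv
  have h1 := hB t ht
  have e : v = z + ((v +ᵥ t) - z) - t := by simp
  rw [e]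
  refine (norm_sub_le _ _).trans (add_le_add ((norm_add_le _ _).trans ?_) h1)
  exact add_le_add le_rfl hx.le

theorem iUnion_vadd_rauzyFractal {a : ℕ} (ha : 2 ≤ a) {α : ℂ}
    (hα : α ^ 3 - (a : ℂ) * α ^ 2 + α - 1 = 0) (hα_im : α.im ≠ 0) :
    (⋃ v ∈ latticeSpan (α - 1) (α * (α - 1)), (v +ᵥ rauzyFractal a α)) = Set.univ := by
  have hT := isCompact_rauzyFractal ha (rauzy_norm_lt_one ha hα hα_im)
  refine Set.eq_univ_of_forall fun z => ?_
  obtain ⟨F, hFL, hF, hFz⟩ :=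
    exists_finite_translates hT (finite_latticeSpan_inter_closedBall hα_im) z
  -- Only the finitely many tiles in `F` matter near `z`, and their union is closed, so
  -- approximating `z` suffices.
  refine Set.biUnion_mono hFL (fun _ _ => le_rfl) ?_
  rw [← (isClosed_biUnion_vadd hT.isClosed hF).closure_eq, Metric.mem_closure_iff]
  intro ε hε
  obtain ⟨x, N, hN, hx, hxz⟩ := exists_integralRep_near ha hα hα_im z (lt_min hε one_pos)
  obtain ⟨v, hv, y, hy, rfl⟩ := exists_rauzyDigits_of_integralRep ha hα hN hx
  refine ⟨v + y, Set.mem_biUnion (hFz _ (hxz.trans_le (min_le_right _ _)) v hv ⟨y, hy, rfl⟩)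
    ⟨y, hy, rfl⟩, ?_⟩
  rw [dist_comm, dist_eq_norm]
  exact hxz.trans_le (min_le_left _ _)

/-- A boundary point of a compact tile lies in another tile of a locally finite covering. -/
lemma exists_mem_vadd_of_mem_frontier {T L : Set ℂ} (hT : IsCompact T)
    (hL : ∀ C : ℝ, {v | v ∈ L ∧ ‖v‖ ≤ C}.Finite) (hcov : (⋃ v ∈ L, (v +ᵥ T)) = Set.univ) {z : ℂ}
    (hz : z ∈ frontier T) : ∃ v ∈ L, v ≠ 0 ∧ z ∈ v +ᵥ T := by
  obtain ⟨F, hFL, hF, hFz⟩ := exists_finite_translates hT hL z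
  have hmem : z ∈ ⋃ v ∈ F \ {0}, (v +ᵥ T) := by
    rw [← (isClosed_biUnion_vadd hT.isClosed (hF.subset Set.sdiff_subset)).closure_eq,
      Metric.mem_closure_iff]
    intro ε hε
    have hz' : z ∈ closure Tᶜ := by
      rw [frontier_eq_closure_inter_closure] at hz
      exact hz.2
    obtain ⟨x, hx, hxz⟩ := Metric.mem_closure_iff.1 hz' _ (lt_min hε one_pos)
    refine ⟨x, ?_, hxz.trans_le (min_le_left _ _)⟩
    have hxu : x ∈ ⋃ v ∈ L, (v +ᵥ T) := hcov ▸ Set.mem_univ x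
    simp only [Set.mem_iUnion] at hxu ⊢
    obtain ⟨v, hv, hxv⟩ := hxu
    refine ⟨v, ⟨hFz x ?_ v hv hxv, ?_⟩, hxv⟩
    · rw [← dist_eq_norm, dist_comm]
      exact hxz.trans_le (min_le_right _ _)
    · rintro rfl
      rw [zero_vadd] at hxv
      exact hx hxv
  simp only [Set.mem_iUnion] at hmem
  obtain ⟨v, hv, hzv⟩ := hmem
  exact ⟨v, hFL hv.1, hv.2, hzv⟩

/-! ### The carry graph and disjointness of interiors -/

/-- One step in the graph of nonzero carry states, where the second string has digit `e`. -/
def carryStep (S : List (ℤ × ℤ × ℤ)) (e : ℕ) : List (ℤ × ℤ × ℤ) :=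
  S.flatMap fun s => (([-1, 0, 1] : List ℤ).filter fun w : ℤ =>
    (s.2.1 = 1 ∧ (e : ℤ) + 1 ≤ s.1 + s.2.2 - w ∨ s.2.1 = 0 ∧ s.1 + s.2.2 - w ≤ (e : ℤ) ∨
      s.2.1 = -1 ∧ s.1 + s.2.2 - w + 2 ≤ (e : ℤ)) ∧
      ¬(s.2.1 = 0 ∧ s.2.2 = 0 ∧ w = 0)).map fun w => ((s.2.1, s.2.2, w) : ℤ × ℤ × ℤ)

/-- A word that cannot be read, as digits of the second string, along nonzero carry states. -/
def killingWord : List ℕ := [0, 0, 0, 1, 0, 1, 0, 0, 1, 0, 0]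

/-- All triples with entries in `{-1, 0, 1}`. -/
def carryStates : List (ℤ × ℤ × ℤ) :=
  ([-1, 0, 1] : List ℤ).flatMap fun x => ([-1, 0, 1] : List ℤ).flatMap fun y =>
    ([-1, 0, 1] : List ℤ).map fun z => (x, y, z)

lemma foldl_carryStep_killingWord : killingWord.foldl carryStep carryStates = [] := by
  decide

/-- Solving the step equation for the first digit `ε` and using `0 ≤ ε ≤ a - 1` gives the filter
conditions. They do not mention `a`: for middle carry `1` or `0` it cancels or drops out, for `-1`
it is weakened to `2 ≤ a`. One finite computation thus serves every `a`. -/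
lemma mem_carryStep {a : ℕ} (ha : 2 ≤ a) {p : ℕ → ℤ} {j e ε : ℕ} (hε : ε + 1 ≤ a)
    (hp : ∀ j, |p j| ≤ 1) (hnz : ∀ j, ¬(p j = 0 ∧ p (j + 1) = 0 ∧ p (j + 2) = 0))
    (hstep : (e : ℤ) - ε = p j - a * p (j + 1) + p (j + 2) - p (j + 3))
    {S : List (ℤ × ℤ × ℤ)} (hS : (p j, p (j + 1), p (j + 2)) ∈ S) :
    (p (j + 1), p (j + 2), p (j + 3)) ∈ carryStep S e := by
  have h3 := abs_le.1 (hp (j + 3))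
  have h1 := abs_le.1 (hp (j + 1))
  have hn := hnz (j + 1)
  simp only [add_assoc, Nat.reduceAdd] at hn
  refine List.mem_flatMap.2 ⟨_, hS, List.mem_map.2 ⟨p (j + 3), List.mem_filter.2 ⟨?_, ?_⟩, rfl⟩⟩
  · simp only [List.mem_cons, List.not_mem_nil, or_false]
    omega
  · rw [decide_eq_true_iff]
    refine ⟨?_, hn⟩
    dsimp only
    rcases (show p (j + 1) = 1 ∨ p (j + 1) = 0 ∨ p (j + 1) = -1 by omega) with h | h | h <;>
      rw [h] at hstep ⊢ <;> omega

lemma mem_foldl_carryStep {a : ℕ} (ha : 2 ≤ a) {p : ℕ → ℤ} {d f : ℕ → ℕ} (hd : ∀ i, d i + 1 ≤ a)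
    (hp : ∀ j, |p j| ≤ 1) (hnz : ∀ j, ¬(p j = 0 ∧ p (j + 1) = 0 ∧ p (j + 2) = 0))
    (hstep : ∀ j, (f (j + 2) : ℤ) - d (j + 2) = p j - a * p (j + 1) + p (j + 2) - p (j + 3))
    (w : List ℕ) (j : ℕ) (hw : ∀ i, i < w.length → f (j + i + 2) = w.getD i 0)
    (S : List (ℤ × ℤ × ℤ)) (hS : (p j, p (j + 1), p (j + 2)) ∈ S) :
    w.foldl carryStep S ≠ [] := by
  induction w generalizing j S with
  | nil => exact List.ne_nil_of_mem hS
  | cons e w ih =>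
    have he : f (j + 2) = e := by simpa using hw 0 (by simp)
    have h := hstep j
    rw [he] at h
    refine ih (j + 1) (fun i hi => ?_) _ (mem_carryStep ha (hd (j + 2)) hp hnz h hS)
    have := hw (i + 1) (by simpa using hi)
    rw [List.getD_cons_succ] at this
    rw [← this]
    congr 1
    ring

lemma mem_carryStates {x y z : ℤ} (hx : |x| ≤ 1) (hy : |y| ≤ 1) (hz : |z| ≤ 1) :
    (x, y, z) ∈ carryStates := by
  have h : ∀ x : ℤ, |x| ≤ 1 → x ∈ ([-1, 0, 1] : List ℤ) := fun x hx => by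
    have := abs_le.1 hx
    simp only [List.mem_cons, List.not_mem_nil, or_false]
    omega
  exact List.mem_flatMap.2 ⟨x, h x hx, List.mem_flatMap.2 ⟨y, h y hy,
    List.mem_map.2 ⟨z, h z hz, rfl⟩⟩⟩

/-- Replace the digits from index `K` on by the killing word followed by zeros. -/
def killTail (d : ℕ → ℕ) (K i : ℕ) : ℕ := if i < K then d i else killingWord.getD (i - K) 0

/-- Each `1` has a `0` at the index just below it, so the word is admissible after any prefix, even
for `a = 2`. -/
lemma killingWord_getD (i : ℕ) : killingWord.getD i 0 = 0 ∨
    (killingWord.getD i 0 = 1 ∧ ∃ k, i = k + 1 ∧ killingWord.getD k 0 = 0) := by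
  rcases lt_or_ge i 11 with h | h
  · interval_cases i <;> simp [killingWord]
  · left
    exact List.getD_eq_default _ _ h

lemma RauzyDigits.killTail {a : ℕ} (ha : 2 ≤ a) {d : ℕ → ℕ} (hd : RauzyDigits a d) {K : ℕ}
    (hK : 3 ≤ K) : RauzyDigits a (killTail d K) := by
  refine ⟨?_, ?_, ?_, fun n => ?_⟩
  · simp [_root_.killTail, show 0 < K by omega, hd.zero]
  · simp [_root_.killTail, show 1 < K by omega, hd.one]
  · simp [_root_.killTail, show 2 < K by omega, hd.two]
  · rcases lt_or_ge (n + 3) K with h | h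
    · simpa [_root_.killTail, h, show n + 2 < K by omega, show n + 1 < K by omega,
        show n < K by omega] using hd.window n
    · have e : _root_.killTail d K (n + 3) = killingWord.getD (n + 3 - K) 0 := by
        simp [_root_.killTail, show ¬(n + 3 < K) by omega]
      unfold RauzyWindow
      rw [e]
      rcases killingWord_getD (n + 3 - K) with h0 | ⟨h1, k, hk, hk0⟩
      · omega
      · have e' : _root_.killTail d K (n + 2) = 0 := by
          simp only [_root_.killTail, show ¬(n + 2 < K) by omega, if_false]
          rw [show n + 2 - K = k by omega, hk0]
        omega

lemma hasSum_killTail (d : ℕ → ℕ) (K : ℕ) (α : ℂ) :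
    HasSum (fun i => (killTail d K i : ℂ) * α ^ i)
      (∑ i ∈ Finset.range K, (d i : ℂ) * α ^ i +
        α ^ K * ∑ i ∈ Finset.range 11, (killingWord.getD i 0 : ℂ) * α ^ i) := by
  have h : HasSum (fun i => (killTail d K i : ℂ) * α ^ i)
      (∑ i ∈ Finset.range (K + 11), (killTail d K i : ℂ) * α ^ i) := by
    refine hasSum_sum_of_ne_finset_zero fun i hi => ?_
    have : K + 11 ≤ i := by simpa using hi
    simp only [killTail, show ¬(i < K) by omega, if_false]
    rw [List.getD_eq_default _ _ (by simp [killingWord]; omega)]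
    simp
  convert h using 1
  rw [Finset.sum_range_add, Finset.mul_sum]
  congr 1
  · refine Finset.sum_congr rfl fun i hi => ?_
    simp [killTail, Finset.mem_range.1 hi]
  · refine Finset.sum_congr rfl fun i _ => ?_
    simp [killTail, pow_add]
    ring

theorem eq_zero_of_interior_inter {a : ℕ} (ha : 2 ≤ a) {α : ℂ}
    (hα : α ^ 3 - (a : ℂ) * α ^ 2 + α - 1 = 0) (hα_im : α.im ≠ 0) {m n : ℤ}
    (h : (interior (rauzyFractal a α) ∩
      ((m * (α - 1) + n * (α * (α - 1)) : ℂ) +ᵥ rauzyFractal a α)).Nonempty) :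
    m = 0 ∧ n = 0 := by
  have h1 := rauzy_norm_lt_one ha hα hα_im
  obtain ⟨_, hz, y, hy, rfl⟩ := h
  obtain ⟨d, hd, hs⟩ := (mem_rauzyFractal_iff ha).1 hy
  set v : ℂ := m * (α - 1) + n * (α * (α - 1)) with hv
  simp only [vadd_eq_add] at hz
  -- The modified strings represent points converging to `v + y`, so for large `K` the point stays
  -- in the fractal.
  have ht : Filter.Tendsto (fun K => v + (∑ i ∈ Finset.range K, (d i : ℂ) * α ^ i +
      α ^ K * ∑ i ∈ Finset.range 11, (killingWord.getD i 0 : ℂ) * α ^ i)) Filter.atTop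
      (nhds (v + (y + 0 * ∑ i ∈ Finset.range 11, (killingWord.getD i 0 : ℂ) * α ^ i))) :=
    (hs.tendsto_sum_nat.add
      ((tendsto_pow_atTop_nhds_zero_of_norm_lt_one h1).mul_const _)).const_add v
  rw [zero_mul, add_zero] at ht
  obtain ⟨K, hK, hK3⟩ := ((ht.eventually (mem_interior_iff_mem_nhds.1 hz)).and
    (Filter.eventually_ge_atTop 3)).exists
  obtain ⟨e, he, hes⟩ := (mem_rauzyFractal_iff ha).1 hK
  obtain ⟨p, p0, p1, p2, hp, hcb, hstep⟩ :=
    exists_carries ha hα hα_im he (hd.killTail ha hK3) hes (hasSum_killTail d K α) rfl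
  by_contra hne
  have hnz : ∀ j, ¬(p j = 0 ∧ p (j + 1) = 0 ∧ p (j + 2) = 0) := by
    rintro j ⟨h0, h1, h2⟩
    have := hcb.eq_zero_of_le j h0 h1 h2
    omega
  -- The state at index `K - 2` is the one that reads digit `K`, the first letter of the word.
  refine mem_foldl_carryStep ha (he.lt ha) hp hnz hstep killingWord (K - 2) (fun i hi => ?_)
    carryStates (mem_carryStates (hp _) (hp _) (hp _)) foldl_carryStep_killingWord
  simp only [killTail, show ¬(K - 2 + i + 2 < K) by omega, if_false]
  congr 1
  omega

theorem inducesPeriodicTiling_rauzyFractal {a : ℕ} (ha : 2 ≤ a) {α : ℂ}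
    (hα : α ^ 3 - (a : ℂ) * α ^ 2 + α - 1 = 0) (hα_im : α.im ≠ 0) :
    InducesPeriodicTiling (rauzyFractal a α) (latticeSpan (α - 1) (α * (α - 1))) := by
  refine ⟨iUnion_vadd_rauzyFractal ha hα hα_im, ?_⟩
  rintro _ ⟨m, n, rfl⟩ _ ⟨m', n', rfl⟩ ⟨x, hx, y, hy, hxy⟩
  set v : ℂ := m * (α - 1) + n * (α * (α - 1)) with hv
  set w : ℂ := m' * (α - 1) + n' * (α * (α - 1)) with hw
  have := eq_zero_of_interior_inter ha hα hα_im (m := m' - m) (n := n' - n) ⟨-v + x, ?_, y, hy, ?_⟩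
  · rw [hv, hw, show m = m' by omega, show n = n' by omega]
  · rw [interior_vadd] at hx
    obtain ⟨t, ht, rfl⟩ := hx
    simpa using ht
  · rw [← hxy]
    simp only [vadd_eq_add, hv, hw]
    push_cast
    ring

/-! ### Periodic expansions and the one-point intersections -/

/-- The digit string with `4`-periodic digits `c 0, c 1, c 2, c 3, c 0, …` from index `2` on. -/
def periodicDigits (c : ℕ → ℕ) : ℕ → ℕ
  | 0 => 0
  | 1 => 0
  | n + 2 => c (n % 4)

lemma hasSum_periodicDigits {α z : ℂ} (h : ‖α‖ < 1) (c : ℕ → ℕ)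
    (hz : z * (1 - α ^ 4) = α ^ 2 * (c 0 + c 1 * α + c 2 * α ^ 2 + c 3 * α ^ 3)) :
    HasSum (fun n => (periodicDigits c n : ℂ) * α ^ n) z := by
  set b := c 0 + c 1 + c 2 + c 3 + 1
  have hb : ∀ n, periodicDigits c n + 1 ≤ b := by
    rintro (_ | _ | n)
    · simp [periodicDigits, b]
    · simp [periodicDigits, b]
    · have : n % 4 < 4 := Nat.mod_lt _ (by norm_num)
      simp only [periodicDigits]
      interval_cases n % 4 <;> omega
  have hs := (summable_digit_mul_pow hb h).hasSum
  set t := ∑' n, (periodicDigits c n : ℂ) * α ^ n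
  have h2 := (hasSum_nat_add_iff' 2).2 hs
  have h6 := (hasSum_nat_add_iff' 6).2 hs
  have hshift : (fun n => (periodicDigits c (n + 6) : ℂ) * α ^ (n + 6)) =
      fun n => α ^ 4 * ((periodicDigits c (n + 2) : ℂ) * α ^ (n + 2)) := by
    ext n
    have : periodicDigits c (n + 6) = periodicDigits c (n + 2) := by
      show c ((n + 4) % 4) = c (n % 4)
      simp
    rw [this]
    ring
  rw [hshift] at h6
  have e := h6.unique (h2.mul_left (α ^ 4))
  simp [Finset.sum_range_succ, periodicDigits] at e
  have h4 : 1 - α ^ 4 ≠ 0 := by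
    intro h0
    have h5 : ‖α ^ 4‖ = 1 := by rw [← sub_eq_zero.1 h0, norm_one]
    rw [norm_pow] at h5
    exact (pow_lt_one₀ (norm_nonneg α) h (by norm_num : 4 ≠ 0)).ne h5
  have : t = z := mul_right_cancel₀ h4 (by rw [hz]; linear_combination e)
  exact this ▸ hs

lemma rauzyDigits_periodicDigits {a : ℕ} {c : ℕ → ℕ} (h0 : c 0 < a)
    (h : RauzyWindow a (c 1) (c 0) 0 0 ∧ RauzyWindow a (c 2) (c 1) (c 0) 0 ∧
      RauzyWindow a (c 3) (c 2) (c 1) (c 0) ∧ RauzyWindow a (c 0) (c 3) (c 2) (c 1) ∧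
      RauzyWindow a (c 1) (c 0) (c 3) (c 2) ∧ RauzyWindow a (c 2) (c 1) (c 0) (c 3)) :
    RauzyDigits a (periodicDigits c) := by
  refine ⟨rfl, rfl, h0, fun n => ?_⟩
  rcases n with _ | _ | n
  · exact h.1
  · exact h.2.1
  · show RauzyWindow a (c ((n + 3) % 4)) (c ((n + 2) % 4)) (c ((n + 1) % 4)) (c (n % 4))
    have : n % 4 < 4 := Nat.mod_lt _ (by norm_num)
    rcases (show n % 4 = 0 ∨ n % 4 = 1 ∨ n % 4 = 2 ∨ n % 4 = 3 by omega) with e | e | e | e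
    · rw [show (n + 3) % 4 = 3 by omega, show (n + 2) % 4 = 2 by omega,
        show (n + 1) % 4 = 1 by omega, e]
      exact h.2.2.1
    · rw [show (n + 3) % 4 = 0 by omega, show (n + 2) % 4 = 3 by omega,
        show (n + 1) % 4 = 2 by omega, e]
      exact h.2.2.2.1
    · rw [show (n + 3) % 4 = 1 by omega, show (n + 2) % 4 = 0 by omega,
        show (n + 1) % 4 = 3 by omega, e]
      exact h.2.2.2.2.1
    · rw [show (n + 3) % 4 = 2 by omega, show (n + 2) % 4 = 1 by omega,
        show (n + 1) % 4 = 0 by omega, e]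
      exact h.2.2.2.2.2

/-- Points with `4`-periodic expansions whose digits are `0` or `a - 1`. -/
lemma mem_rauzyFractal_of_periodic {a : ℕ} (ha : 2 ≤ a) {α z : ℂ} (h : ‖α‖ < 1)
    (x₀ x₁ x₂ x₃ : ℕ)
    (hx : x₀ ≤ 1 ∧ x₁ ≤ 1 ∧ x₂ ≤ 1 ∧ x₃ ≤ 1 ∧ (x₀ = 0 ∨ x₂ = 0) ∧ (x₁ = 0 ∨ x₃ = 0))
    (hz : z * (1 - α ^ 4) = α ^ 2 * (a - 1) * (x₀ + x₁ * α + x₂ * α ^ 2 + x₃ * α ^ 3)) :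
    z ∈ rauzyFractal a α := by
  rw [mem_rauzyFractal_iff ha]
  have ea : ((a - 1 : ℕ) : ℂ) = a - 1 := by push_cast [show 1 ≤ a by omega]; ring
  have key : ∀ x y z w : ℕ, x ≤ 1 → y ≤ 1 → (x = 0 ∨ z = 0) → (y = 0 ∨ w = 0) →
      RauzyWindow a (x * (a - 1)) (y * (a - 1)) (z * (a - 1)) (w * (a - 1)) := by
    intro x y z w hx hy hxz hyw
    unfold RauzyWindow
    interval_cases x <;> interval_cases y <;> simp_all <;> omega
  obtain ⟨h0, h1, h2, h3, h02, h13⟩ := hx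
  refine ⟨periodicDigits fun i => ([x₀, x₁, x₂, x₃].getD i 0) * (a - 1),
    rauzyDigits_periodicDigits ?_ ⟨?_, ?_, ?_, ?_, ?_, ?_⟩, hasSum_periodicDigits h _ ?_⟩
  · interval_cases x₀ <;> simp <;> omega
  · simpa using key x₁ x₀ 0 0 h1 h0 (by simp) (by simp)
  · simpa using key x₂ x₁ x₀ 0 h2 h1 (by tauto) (by simp)
  · simpa using key x₃ x₂ x₁ x₀ h3 h2 (by tauto) (by tauto)
  · simpa using key x₀ x₃ x₂ x₁ h0 h3 (by tauto) (by tauto)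
  · simpa using key x₁ x₀ x₃ x₂ h1 h0 (by tauto) (by tauto)
  · simpa using key x₂ x₁ x₀ x₃ h2 h1 (by tauto) (by tauto)
  · simp [ea]
    rw [hz]
    ring

/-- From the state `(-1, 1, 1)` every digit difference must be extremal, `±(a - 1)`. This fixes both
digits and the next carry, and the state recurs after four steps. -/
lemma rauzy_step_digits {a : ℕ} {d d' : ℕ → ℕ} (hd : ∀ i, d i + 1 ≤ a)
    (hd' : ∀ i, d' i + 1 ≤ a) {p : ℕ → ℤ} (hp : ∀ j, |p j| ≤ 1)
    (hstep : ∀ j, (d' (j + 2) : ℤ) - d (j + 2) = p j - a * p (j + 1) + p (j + 2) - p (j + 3))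
    {j : ℕ} (h0 : p j = -1) (h1 : p (j + 1) = 1) (h2 : p (j + 2) = 1) (k : ℕ) :
    (p (j + 4 * k) = -1 ∧ p (j + 4 * k + 1) = 1 ∧ p (j + 4 * k + 2) = 1) ∧
      d (j + 4 * k + 2) = a - 1 ∧ d (j + 4 * k + 3) = a - 1 ∧ d (j + 4 * k + 4) = 0 ∧
      d (j + 4 * k + 5) = 0 := by
  have block : ∀ i, p i = -1 → p (i + 1) = 1 → p (i + 2) = 1 →
      (p (i + 4) = -1 ∧ p (i + 5) = 1 ∧ p (i + 6) = 1) ∧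
      d (i + 2) = a - 1 ∧ d (i + 3) = a - 1 ∧ d (i + 4) = 0 ∧ d (i + 5) = 0 := by
    intro i h0 h1 h2
    have b3 := abs_le.1 (hp (i + 3))
    have b4 := abs_le.1 (hp (i + 4))
    have b5 := abs_le.1 (hp (i + 5))
    have b6 := abs_le.1 (hp (i + 6))
    have s0 := hstep i
    have s1 := hstep (i + 1)
    have s2 := hstep (i + 2)
    have s3 := hstep (i + 3)
    have l2 := hd (i + 2)
    have l3 := hd (i + 3)
    have l4' := hd' (i + 4)
    have l5' := hd' (i + 5)
    simp only [add_assoc, Nat.reduceAdd] at *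
    rw [h0, h1, h2] at s0
    have h3 : p (i + 3) = -1 := by omega
    rw [h1, h2, h3] at s1
    have h4 : p (i + 4) = -1 := by omega
    rw [h2, h3, h4] at s2
    have h5 : p (i + 5) = 1 := by omega
    rw [h3, h4, h5] at s3
    omega
  induction k with
  | zero => exact ⟨⟨h0, h1, h2⟩, (block j h0 h1 h2).2⟩
  | succ k ih =>
    obtain ⟨⟨g0, g1, g2⟩, -⟩ := ih
    have e := (block _ g0 g1 g2).1
    exact ⟨e, (block (j + 4 * (k + 1)) e.1 e.2.1 e.2.2).2⟩

theorem rauzyFractal_inter_add {a : ℕ} (ha : 2 ≤ a) {α : ℂ}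
    (hα : α ^ 3 - (a : ℂ) * α ^ 2 + α - 1 = 0) (hα_im : α.im ≠ 0) :
    rauzyFractal a α ∩ (((1 + α) * (α - 1)) +ᵥ rauzyFractal a α) = {-1} := by
  have hn := rauzy_norm_lt_one ha hα hα_im
  have ea : ((a - 1 : ℕ) : ℂ) = a - 1 := by push_cast [show 1 ≤ a by omega]; ring
  -- With period digits `(a-1)(a-1)00` the string represents `-1`; shifted by two places it
  -- represents `-α²`.
  refine Set.eq_singleton_iff_unique_mem.2 ⟨⟨?_, -α ^ 2, ?_, ?_⟩, ?_⟩
  · refine mem_rauzyFractal_of_periodic ha hn 1 1 0 0 (by simp) ?_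
    push_cast
    linear_combination (1 + α) * hα
  · refine mem_rauzyFractal_of_periodic ha hn 0 0 1 1 (by simp) ?_
    push_cast
    linear_combination α ^ 2 * (1 + α) * hα
  · simp only [vadd_eq_add]
    ring
  · rintro z ⟨hz, y, hy, hzy⟩
    obtain ⟨d, hd, hs⟩ := (mem_rauzyFractal_iff ha).1 hz
    obtain ⟨d', hd', hs'⟩ := (mem_rauzyFractal_iff ha).1 hy
    obtain ⟨p, p0, p1, p2, hp, -, hstep⟩ :=
      exists_carries ha hα hα_im hd hd' hs hs' (m := 1) (n := 1)
        (by rw [← hzy]; simp only [vadd_eq_add]; push_cast; ring)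
    have H := rauzy_step_digits (hd.lt ha) (hd'.lt ha) hp hstep p0 p1 p2
    have hdig : d = periodicDigits fun i => [a - 1, a - 1, 0, 0].getD i 0 := by
      funext i
      rcases i with _ | _ | i
      · exact hd.zero
      · exact hd.one
      · have h := (H (i / 4)).2
        have hi := Nat.div_add_mod i 4
        simp only [periodicDigits]
        rcases (show i % 4 = 0 ∨ i % 4 = 1 ∨ i % 4 = 2 ∨ i % 4 = 3 by omega) with e | e | e | e <;>
          rw [e]
        · rw [show i + 1 + 1 = 0 + 4 * (i / 4) + 2 by omega, h.1]; rfl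
        · rw [show i + 1 + 1 = 0 + 4 * (i / 4) + 3 by omega, h.2.1]; rfl
        · rw [show i + 1 + 1 = 0 + 4 * (i / 4) + 4 by omega, h.2.2.1]; rfl
        · rw [show i + 1 + 1 = 0 + 4 * (i / 4) + 5 by omega, h.2.2.2]; rfl
    rw [hdig] at hs
    refine hs.unique (hasSum_periodicDigits hn _ ?_)
    simp [ea]
    linear_combination (1 + α) * hα

theorem rauzyFractal_inter_sub {a : ℕ} (ha : 2 ≤ a) {α : ℂ}
    (hα : α ^ 3 - (a : ℂ) * α ^ 2 + α - 1 = 0) (hα_im : α.im ≠ 0) :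
    rauzyFractal a α ∩ (((α - 1) * (α - 1)) +ᵥ rauzyFractal a α) = {-α} := by
  have hn := rauzy_norm_lt_one ha hα hα_im
  have ea : ((a - 1 : ℕ) : ℂ) = a - 1 := by push_cast [show 1 ≤ a by omega]; ring
  refine Set.eq_singleton_iff_unique_mem.2 ⟨⟨?_, -α ^ 2 + α - 1, ?_, ?_⟩, ?_⟩
  · refine mem_rauzyFractal_of_periodic ha hn 0 1 1 0 (by simp) ?_
    push_cast
    linear_combination α * (1 + α) * hα
  · refine mem_rauzyFractal_of_periodic ha hn 1 0 0 1 (by simp) ?_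
    push_cast
    linear_combination (1 + α ^ 3) * hα
  · simp only [vadd_eq_add]
    ring
  · rintro z ⟨hz, y, hy, hzy⟩
    obtain ⟨d, hd, hs⟩ := (mem_rauzyFractal_iff ha).1 hz
    obtain ⟨d', hd', hs'⟩ := (mem_rauzyFractal_iff ha).1 hy
    obtain ⟨p, p0, p1, p2, hp, -, hstep⟩ :=
      exists_carries ha hα hα_im hd hd' hs hs' (m := -1) (n := 1)
        (by rw [← hzy]; simp only [vadd_eq_add]; push_cast; ring)
    have l' := hd'.lt ha 2
    have s := hstep 0
    have b := abs_le.1 (hp 3)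
    simp only [zero_add] at s
    rw [p0, p1, p2] at s
    -- The start `(-1, -1, 1)` allows only this carry, so one digit later the periodic state `(-1,
    -- 1, 1)` is reached.
    have p3 : p 3 = 1 := by omega
    have d2 : d 2 = 0 := by omega
    have H := rauzy_step_digits (hd.lt ha) (hd'.lt ha) hp hstep (j := 1) p1 p2 p3
    have hdig : d = periodicDigits fun i => [0, a - 1, a - 1, 0].getD i 0 := by
      funext i
      rcases i with _ | _ | _ | i
      · exact hd.zero
      · exact hd.one
      · exact d2
      · have h := (H (i / 4)).2
        have hi := Nat.div_add_mod i 4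
        simp only [periodicDigits]
        rcases (show i % 4 = 0 ∨ i % 4 = 1 ∨ i % 4 = 2 ∨ i % 4 = 3 by omega) with e | e | e | e
        · rw [show (i + 1) % 4 = 1 by omega, show i + 1 + 1 + 1 = 1 + 4 * (i / 4) + 2 by omega, h.1]
          rfl
        · rw [show (i + 1) % 4 = 2 by omega, show i + 1 + 1 + 1 = 1 + 4 * (i / 4) + 3 by omega,
            h.2.1]
          rfl
        · rw [show (i + 1) % 4 = 3 by omega, show i + 1 + 1 + 1 = 1 + 4 * (i / 4) + 4 by omega,
            h.2.2.1]
          rfl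
        · rw [show (i + 1) % 4 = 0 by omega, show i + 1 + 1 + 1 = 1 + 4 * (i / 4) + 5 by omega,
            h.2.2.2]
          rfl
    rw [hdig] at hs
    refine hs.unique (hasSum_periodicDigits hn _ ?_)
    simp [ea]
    linear_combination α * (1 + α) * hα

/-! ### Neighbors and boundary -/

lemma latticeSpan_injective {α : ℂ} (hα_im : α.im ≠ 0) {m n m' n' : ℤ}
    (h : (m : ℂ) * (α - 1) + n * (α * (α - 1)) = m' * (α - 1) + n' * (α * (α - 1))) :
    m = m' ∧ n = n' := by
  have hu : α - 1 ≠ 0 := fun h => hα_im (by rw [sub_eq_zero.1 h]; simp)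
  rw [latticeSpan_eq, latticeSpan_eq] at h
  have h' := mul_right_cancel₀ hu h
  have him := congrArg Complex.im h'
  simp at him
  have hn : n = n' := him.resolve_right hα_im
  subst hn
  exact ⟨by exact_mod_cast add_right_cancel h', rfl⟩

lemma rauzyVectors_eq (α : ℂ) :
    rauzyVectors α = (fun p : ℤ × ℤ => (p.1 : ℂ) * (α - 1) + p.2 * (α * (α - 1))) ''
      ({(1, 0), (-1, 0), (0, 1), (0, -1), (1, 1), (-1, -1), (1, -1), (-1, 1)} :
        Finset (ℤ × ℤ)) := by
  simp only [Finset.coe_insert, Finset.coe_singleton, Set.image_insert_eq, Set.image_singleton,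
    rauzyVectors]
  exact congrArg₂ insert (by push_cast; ring) <| congrArg₂ insert (by push_cast; ring) <|
    congrArg₂ insert (by push_cast; ring) <|
    congrArg₂ insert (by push_cast; ring) <|
    congrArg₂ insert (by push_cast; ring) <|
    congrArg₂ insert (by push_cast; ring) <|
    congrArg₂ insert (by push_cast; ring) <|
    congrArg singleton (by push_cast; ring)

theorem ncard_rauzyVectors {α : ℂ} (hα_im : α.im ≠ 0) : (rauzyVectors α).ncard = 8 := by
  rw [rauzyVectors_eq, Set.ncard_image_of_injective, Set.ncard_coe_finset]
  · rfl
  · rintro ⟨m, n⟩ ⟨m', n'⟩ h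
    obtain ⟨rfl, rfl⟩ := latticeSpan_injective hα_im h
    rfl

lemma nonempty_inter_neg_vadd {T : Set ℂ} {v : ℂ} (h : (T ∩ (v +ᵥ T)).Nonempty) :
    (T ∩ (-v +ᵥ T)).Nonempty := by
  obtain ⟨_, hz, y, hy, rfl⟩ := h
  exact ⟨y, hy, v +ᵥ y, hz, by simp⟩

theorem neighborVectors_rauzyFractal {a : ℕ} (ha : 2 ≤ a) {α : ℂ}
    (hα : α ^ 3 - (a : ℂ) * α ^ 2 + α - 1 = 0) (hα_im : α.im ≠ 0) :
    neighborVectors (rauzyFractal a α) (latticeSpan (α - 1) (α * (α - 1))) = rauzyVectors α := by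
  have hn := rauzy_norm_lt_one ha hα hα_im
  apply Set.Subset.antisymm
  · rintro _ ⟨⟨m, n, rfl⟩, hne, z, hz, y, hy, hzy⟩
    obtain ⟨d, hd, hs⟩ := (mem_rauzyFractal_iff ha).1 hz
    obtain ⟨d', hd', hs'⟩ := (mem_rauzyFractal_iff ha).1 hy
    obtain ⟨p, -, p1, p2, hp, -, -⟩ := exists_carries ha hα hα_im hd hd' hs hs' hzy.symm
    have b1 := abs_le.1 (p1 ▸ hp 1)
    have b2 := abs_le.1 (p2 ▸ hp 2)
    have hmn : ¬(m = 0 ∧ n = 0) := by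
      rintro ⟨rfl, rfl⟩
      simp at hne
    rw [rauzyVectors_eq]
    refine ⟨(m, n), ?_, rfl⟩
    simp only [Finset.coe_insert, Finset.coe_singleton, Set.mem_insert_iff, Set.mem_singleton_iff,
      Prod.mk.injEq]
    omega
  · have h4 : 1 - α ^ 4 ≠ 0 := by
      intro h0
      have h5 : ‖α ^ 4‖ = 1 := by rw [← sub_eq_zero.1 h0, norm_one]
      rw [norm_pow] at h5
      exact (pow_lt_one₀ (norm_nonneg α) hn (by norm_num : 4 ≠ 0)).ne h5
    -- The cubic equation says `(a - 1) α² = (α - 1)(1 + α²)`. Hence shifting the string with period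
    -- digits `(a-1)000` by two places changes its value by `α - 1`; starting one place later gives
    -- `α (α - 1)`.
    have n1 : (rauzyFractal a α ∩ ((α - 1) +ᵥ rauzyFractal a α)).Nonempty := by
      refine ⟨α ^ 2 * (a - 1) / (1 - α ^ 4), ?_, α ^ 4 * (a - 1) / (1 - α ^ 4), ?_, ?_⟩
      · refine mem_rauzyFractal_of_periodic ha hn 1 0 0 0 (by simp) ?_
        field_simp
        push_cast
        ring
      · refine mem_rauzyFractal_of_periodic ha hn 0 0 1 0 (by simp) ?_
        field_simp
        push_cast
        ring
      · simp only [vadd_eq_add]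
        field_simp
        linear_combination (1 - α ^ 2) * hα
    have n2 : (rauzyFractal a α ∩ ((α * (α - 1)) +ᵥ rauzyFractal a α)).Nonempty := by
      refine ⟨α ^ 3 * (a - 1) / (1 - α ^ 4), ?_, α ^ 5 * (a - 1) / (1 - α ^ 4), ?_, ?_⟩
      · refine mem_rauzyFractal_of_periodic ha hn 0 1 0 0 (by simp) ?_
        field_simp
        push_cast
        ring
      · refine mem_rauzyFractal_of_periodic ha hn 0 0 0 1 (by simp) ?_
        field_simp
        push_cast
        ring
      · simp only [vadd_eq_add]
        field_simp
        linear_combination α * (1 - α ^ 2) * hα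
    have n3 : (rauzyFractal a α ∩ (((1 + α) * (α - 1)) +ᵥ rauzyFractal a α)).Nonempty := by
      rw [rauzyFractal_inter_add ha hα hα_im]
      exact Set.singleton_nonempty _
    have n4 : (rauzyFractal a α ∩ (((α - 1) * (α - 1)) +ᵥ rauzyFractal a α)).Nonempty := by
      rw [rauzyFractal_inter_sub ha hα hα_im]
      exact Set.singleton_nonempty _
    intro v hv
    refine ⟨?_, ?_, ?_⟩
    · rw [rauzyVectors_eq] at hv
      obtain ⟨⟨m, n⟩, -, rfl⟩ := hv
      exact ⟨m, n, rfl⟩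
    · rw [rauzyVectors_eq] at hv
      obtain ⟨⟨m, n⟩, hmn, rfl⟩ := hv
      intro h0
      obtain ⟨rfl, rfl⟩ := latticeSpan_injective hα_im (m' := 0) (n' := 0) (by simpa using h0)
      revert hmn
      simp
    · have e1 : (1 - α) * (α - 1) = -((α - 1) * (α - 1)) := by ring
      rcases hv with rfl | rfl | rfl | rfl | rfl | rfl | rfl | rfl
      · exact n1
      · exact nonempty_inter_neg_vadd n1
      · exact n2
      · exact nonempty_inter_neg_vadd n2
      · exact n3
      · exact nonempty_inter_neg_vadd n3
      · rw [e1]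
        exact nonempty_inter_neg_vadd n4
      · rw [e1, neg_neg]
        exact n4

theorem frontier_rauzyFractal {a : ℕ} (ha : 2 ≤ a) {α : ℂ}
    (hα : α ^ 3 - (a : ℂ) * α ^ 2 + α - 1 = 0) (hα_im : α.im ≠ 0) :
    frontier (rauzyFractal a α) =
      ⋃ v ∈ rauzyVectors α, rauzyFractal a α ∩ (v +ᵥ rauzyFractal a α) := by
  have hT := isCompact_rauzyFractal ha (rauzy_norm_lt_one ha hα hα_im)
  rw [← neighborVectors_rauzyFractal ha hα hα_im]
  ext z
  simp only [Set.mem_iUnion]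
  constructor
  · intro hz
    have hzT := hT.isClosed.frontier_subset hz
    obtain ⟨v, hv, hv0, hzv⟩ := exists_mem_vadd_of_mem_frontier hT
      (finite_latticeSpan_inter_closedBall hα_im) (iUnion_vadd_rauzyFractal ha hα hα_im) hz
    exact ⟨v, ⟨hv, hv0, z, hzT, hzv⟩, hzT, hzv⟩
  · rintro ⟨v, ⟨hv, hv0, -⟩, hzT, hzv⟩
    refine ⟨subset_closure hzT, fun hint => hv0 ?_⟩
    exact ((inducesPeriodicTiling_rauzyFractal ha hα hα_im).2 0 ⟨0, 0, by simp⟩ v hv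
      ⟨z, by rwa [zero_vadd], hzv⟩).symm

theorem proposition5p1 (a : ℕ) (ha : 2 ≤ a) (α : ℂ)
    (hα : α ^ 3 - (a : ℂ) * α ^ 2 + α - 1 = 0) (hα_im : α.im ≠ 0) :
    InducesPeriodicTiling (rauzyFractal a α) (latticeSpan (α - 1) (α * (α - 1))) ∧
    frontier (rauzyFractal a α) =
      ⋃ v ∈ rauzyVectors α, rauzyFractal a α ∩ (v +ᵥ rauzyFractal a α) ∧
    neighborVectors (rauzyFractal a α) (latticeSpan (α - 1) (α * (α - 1))) = rauzyVectors α ∧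
    (rauzyVectors α).ncard = 8 ∧
    rauzyFractal a α ∩ (((1 + α) * (α - 1)) +ᵥ rauzyFractal a α) = {-1} ∧
    rauzyFractal a α ∩ (((α - 1) * (α - 1)) +ᵥ rauzyFractal a α) = {-α} :=
  ⟨inducesPeriodicTiling_rauzyFractal ha hα hα_im, frontier_rauzyFractal ha hα hα_im,
    neighborVectors_rauzyFractal ha hα hα_im, ncard_rauzyVectors hα_im,
    rauzyFractal_inter_add ha hα hα_im, rauzyFractal_inter_sub ha hα hα_im⟩
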